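/- Conventions. All manifolds and maps are smooth. For an almost quaternionic manifold $M$, let $Q_M\subseteq\mathrm{End}(TM)$ be its rank-three oriented Euclidean bundle, locally spanned by smooth positive orthonormal frames $(I,J,K)$ with $I^2=J^2=K^2=IJK=-\mathrm{Id}$, and let $\pi_M:Z_M\to M$ be its unit sphere bundle, i.e. the bundle of those $J\in Q_M$ with $J^2=-\mathrm{Id}$. A *quaternionic manifold* is an almost quaternionic manifold endowed with a *quaternionic connection* $\nabla$, that is, a torsion-free connection on $M$ which induces a connection on $Q_M$ and which, if $\dim M=4$, is moreover an anti-self-dual Weyl connection (the self-dual part of the Weyl tensor vanishes). For $J\in Z_M$, with $x=\pi_M(J)$, denote by $T^{0,1;J}_xM\subseteq T_xM\otimes\mathbb C$ the eigenspace of $J$ for $-\mathrm i$. The connection $\nabla$ induces a horizontal distribution $\mathscr H\subseteq TZ_M$, hence a splitting $T_JZ_M=\mathscr H_J\oplus\ker(d\pi_M)_J$ with $\mathscr H_J=T_xM$. The *twistorial structure* of $M$ is given by the almost complex structure $\mathcal J_M$ on $Z_M$ which preserves this splitting, acts as $J$ on $\mathscr H_J=T_xM$, and acts as $K\mapsto J\circ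 K$ on $\ker(d\pi_M)_J=\{K\in (Q_M)_x: K\perp J\}$. **Proposition 3.2.** Let $M$ and $N$ be quaternionic manifolds, with quaternionic connections $\nabla^M$ and $\nabla^N$. Let $\varphi:M\to N$ be a (smooth) map and let $\Phi:Z_M\to Z_N$ be a (smooth) map with $\pi_N\circ\Phi=\varphi\circ\pi_M$, such that $\varphi$ is a quaternionic map with respect to $\Phi$, i.e. $$d\varphi_{\pi_M(J)}\circ J=\Phi(J)\circ d\varphi_{\pi_M(J)}\qquad\text{for any } J\in Z_M .$$ Suppose that $\varphi$ has rank at least one at each point of $M$, i.e. $d\varphi_x\neq0$ for any $x\in M$; then $\Phi$ extends uniquely to an isomorphism of vector bundles $Q_M=\varphi^*(Q_N)$. The following assertions are equivalent: (i) $\varphi$ is twistorial with respect to $\Phi$, i.e. $\Phi:(Z_M,\mathcal J_M)\to(Z_N,\mathcal J_N)$ is holomorphic: it is smooth and $d\Phi\circ\mathcal J_M=\mathcal J_N\circ d\Phi$. (ii) $(\nabla d\varphi)\bigl(T^{0,1;J}_{\pi_M(J)}M,\,T^{0,1;J}_{\pi_M(J)}M\bigr)\subseteq T^{0,1;\Phi(J)}_{\varphi(\pi_M(J))}N$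 for any $J\in Z_M$, where $\nabla$ is the connection on $\mathrm{Hom}(TM,\varphi^*(TN))$ induced by $\nabla^M$ and $\nabla^N$, and $\nabla d\varphi$ is extended complex bilinearly. (iii) $A(JX)J=J\circ(A(X)J)$ for any $J\in Z_M$ and $X\in T_{\pi_M(J)}M$, where $A$ is the difference between the connections on $Q_M=\varphi^*(Q_N)$ induced by $\nabla^M$ and $\nabla^N$. -/

import Mathlib

open Bundle
open scoped Manifold ContDiff Topology TensorProduct

noncomputable section

/-! ## Quaternionic triples -/

/-- The quaternionic identities `I² = J² = K² = IJK = -1`. -/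
def IsQuaternionicTriple {R : Type*} [Ring R] (I J K : R) : Prop :=
  I * I = -1 ∧ J * J = -1 ∧ K * K = -1 ∧ I * J * K = -1

theorem IsQuaternionicTriple.mul_self {R : Type*} [Ring R] [Algebra ℝ R] {I J K : R}
    (h : IsQuaternionicTriple I J K) (a b c : ℝ) :
    (a • I + b • J + c • K) * (a • I + b • J + c • K) = -((a ^ 2 + b ^ 2 + c ^ 2) • (1 : R)) := by
  obtain ⟨hI, hJ, hK, hIJK⟩ := h
  have hIJ : I * J = K := by
    have : I * J * K * K = -K := by rw [hIJK]; simp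
    rw [mul_assoc, hK] at this
    simpa using this
  have hJK : J * K = I := by
    have : I * (I * J * K) = -I := by rw [hIJK]; simp
    rw [mul_assoc, ← mul_assoc, hI] at this
    simpa using this
  have hJI : J * I = -K := by
    have h1 : J * I * J = I := by rw [mul_assoc, hIJ, hJK]
    have h2 : J * I * J * J = K := by rw [h1, hIJ]
    rw [mul_assoc, hJ] at h2
    rw [← h2]; simp
  have hIK : I * K = -J := by rw [← hIJ, ← mul_assoc, hI]; simp
  have hKI : K * I = J := by rw [← hIJ, mul_assoc, hJI, mul_neg, hIK]; simp
  have hKJ : K * J = -I := by rw [← hIJ, mul_assoc, hJ]; simp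
  simp only [mul_add, add_mul, smul_mul_assoc, mul_smul_comm, hI, hJ, hK, hIJ, hJK,
    hJI, hIK, hKI, hKJ]
  module

/-! ## Endomorphisms of the tangent bundle and induced connections -/

section Connections

variable {E : Type*} [NormedAddCommGroup E] [NormedSpace ℝ E] [FiniteDimensional ℝ E]
  {M : Type*} [TopologicalSpace M] [ChartedSpace E M] [IsManifold 𝓘(ℝ, E) ∞ M]
  {E' : Type*} [NormedAddCommGroup E'] [NormedSpace ℝ E'] [FiniteDimensional ℝ E']
  {N : Type*} [TopologicalSpace N] [ChartedSpace E' N] [IsManifold 𝓘(ℝ, E') ∞ N]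

/-- `End(T_x M)`. -/
abbrev EndT (E : Type*) [NormedAddCommGroup E] [NormedSpace ℝ E]
    {M : Type*} [TopologicalSpace M] [ChartedSpace E M] (x : M) : Type _ :=
  TangentSpace 𝓘(ℝ, E) x →L[ℝ] TangentSpace 𝓘(ℝ, E) x

/-- The total space of the vector bundle `End(TM)`, a smooth manifold. -/
abbrev EndTotal (E : Type*) [NormedAddCommGroup E] [NormedSpace ℝ E]
    (M : Type*) [TopologicalSpace M] [ChartedSpace E M] [IsManifold 𝓘(ℝ, E) ∞ M] : Type _ :=
  TotalSpace (E →L[ℝ] E) (fun x : M => EndT E x)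

/-- The model with corners of the manifold `End(TM)`. -/
abbrev endModel (E : Type*) [NormedAddCommGroup E] [NormedSpace ℝ E] :
    ModelWithCorners ℝ (E × (E →L[ℝ] E)) (ModelProd E (E →L[ℝ] E)) :=
  𝓘(ℝ, E).prod 𝓘(ℝ, E →L[ℝ] E)

/-- A connection on the manifold `M` (a connection on its tangent bundle). -/
abbrev Connection (E : Type*) [NormedAddCommGroup E] [NormedSpace ℝ E]
    (M : Type*) [TopologicalSpace M] [ChartedSpace E M] [IsManifold 𝓘(ℝ, E) ∞ M] : Type _ :=
  CovariantDerivative 𝓘(ℝ, E) E (TangentSpace 𝓘(ℝ, E) : M → Type _)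



/-- The local vector field around `x` with value `w` at `x` whose coordinates, in the preferred
trivialization of the tangent bundle at `x`, are constant (and zero outside its domain). -/
def constField (x : M) (w : TangentSpace 𝓘(ℝ, E) x) (y : M) : TangentSpace 𝓘(ℝ, E) y :=
  (trivializationAt E (TangentSpace 𝓘(ℝ, E) : M → Type _) x).symmL ℝ y
    ((trivializationAt E (TangentSpace 𝓘(ℝ, E) : M → Type _) x).continuousLinearMapAt ℝ x w)

set_option linter.unusedSectionVars false in
theorem mdifferentiableAt_constField (x : M) (w : TangentSpace 𝓘(ℝ, E) x) :
    MDifferentiableAt 𝓘(ℝ, E) (𝓘(ℝ, E).prod 𝓘(ℝ, E))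
      (fun y => TotalSpace.mk' E y (constField x w y)) x := by
  have hx := FiberBundle.mem_baseSet_trivializationAt E (TangentSpace 𝓘(ℝ, E) : M → Type _) x
  refine (FiberBundle.mdifferentiableAt_extend 𝓘(ℝ, E) E w).congr_of_eventuallyEq ?_
  filter_upwards [(trivializationAt E (TangentSpace 𝓘(ℝ, E) : M → Type _)
    x).open_baseSet.mem_nhds hx] with y hy
  simp only [constField, FiberBundle.extend, Trivialization.symmL_apply _ hy,
    Trivialization.continuousLinearMapAt_apply,
    Trivialization.coe_linearMapAt_of_mem _ hx]

/-- The connection form of `∇` at `x` in the preferred chart at `x`: `christoffel ∇ x v w` is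
`∇_v W` at `x`, where `W` is the local vector field with constant coordinates and `W x = w`.
Thus `(∇_v Y)(x)` is the derivative of the coordinates of `Y` plus `christoffel ∇ x v (Y x)`. -/
def christoffel (cov : Connection E M) (x : M) (v : TangentSpace 𝓘(ℝ, E) x) : EndT E x :=
  haveI : FiniteDimensional ℝ (TangentSpace 𝓘(ℝ, E) x) := inferInstanceAs (FiniteDimensional ℝ E)
  haveI : T2Space (TangentSpace 𝓘(ℝ, E) x) := inferInstanceAs (T2Space E)
  LinearMap.toContinuousLinearMap
    { toFun := fun w => cov (constField x w) x v
      map_add' := fun w w' => by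
        have h : constField x (w + w') = constField x w + constField x w' := by
          funext y; simp [constField]
        rw [h, cov.isCovariantDerivativeOnUniv.add (mdifferentiableAt_constField x w)
          (mdifferentiableAt_constField x w')]
        rfl
      map_smul' := fun c w => by
        have h : constField x (c • w) = c • constField x w := by
          funext y; simp [constField]
        rw [h, cov.isCovariantDerivativeOnUniv.smul_const c (mdifferentiableAt_constField x w)]
        rfl }


theorem christoffel_add (cov : Connection E M) (x : M) (v v' : TangentSpace 𝓘(ℝ, E) x) :
    christoffel cov x (v + v') = christoffel cov x v + christoffel cov x v' := by
  ext w; exact map_add (cov (constField x w) x) v v'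

theorem christoffel_smul (cov : Connection E M) (x : M) (c : ℝ) (v : TangentSpace 𝓘(ℝ, E) x) :
    christoffel cov x (c • v) = c • christoffel cov x v := by
  ext w; exact map_smul (cov (constField x w) x) c v

/-- Let `f : B → M` and `g : B → N` be maps from a manifold `B`, and let `h` be a section of the
bundle `Hom(f^*(TM), g^*(TN))`. This is the differential at `b` of the matrix of `h` in the preferred
charts at `f b` and `g b`. -/
def homCoordDeriv {EB : Type*} [NormedAddCommGroup EB] [NormedSpace ℝ EB] {HB : Type*}
    [TopologicalSpace HB] {B : Type*} [TopologicalSpace B] [ChartedSpace HB B]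
    (IB : ModelWithCorners ℝ EB HB) (f : B → M) (g : B → N)
    (h : ∀ b, TangentSpace 𝓘(ℝ, E) (f b) →L[ℝ] TangentSpace 𝓘(ℝ, E') (g b)) (b : B) :
    TangentSpace IB b →L[ℝ] (E →L[ℝ] E') :=
  mfderiv IB 𝓘(ℝ, E →L[ℝ] E') (inTangentCoordinates 𝓘(ℝ, E) 𝓘(ℝ, E') f g h b) b

/-- The connection induced by the connections `covM` of `M` and `covN` of `N` on the bundle
`Hom(f^*(TM), g^*(TN))` over a manifold `B`, where `f : B → M` and `g : B → N` are maps: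
`homCov covM covN f g h b v` is `(∇_v h)(b)`. In the preferred charts at `f b` and `g b` this is the
derivative of the matrix of `h`, plus the connection form of `g^*(covN)` composed with `h`, minus
`h` composed with the connection form of `f^*(covM)`.

For `f = g = id` it is the connection induced on `End(TM)`, for `f = g` the pull-back of the latter,
and for `f = id` the connection induced on `Hom(TM, g^*(TN))`. -/
def homCov {EB : Type*} [NormedAddCommGroup EB] [NormedSpace ℝ EB] {HB : Type*}
    [TopologicalSpace HB] {B : Type*} [TopologicalSpace B] [ChartedSpace HB B]
    (IB : ModelWithCorners ℝ EB HB) (covM : Connection E M) (covN : Connection E' N)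
    (f : B → M) (g : B → N)
    (h : ∀ b, TangentSpace 𝓘(ℝ, E) (f b) →L[ℝ] TangentSpace 𝓘(ℝ, E') (g b))
    (b : B) (v : TangentSpace IB b) :
    TangentSpace 𝓘(ℝ, E) (f b) →L[ℝ] TangentSpace 𝓘(ℝ, E') (g b) :=
  (show TangentSpace 𝓘(ℝ, E) (f b) →L[ℝ] TangentSpace 𝓘(ℝ, E') (g b) from
      homCoordDeriv IB f g h b v)
    + christoffel covN (g b) (mfderiv IB 𝓘(ℝ, E') g b v) ∘L h b
    - h b ∘L christoffel covM (f b) (mfderiv IB 𝓘(ℝ, E) f b v)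

/-- `∇_v S` at `x`, for a field `S` of endomorphisms of the tangent bundle of `M`. -/
def endCov (cov : Connection E M) (S : ∀ y : M, EndT E y) (x : M) (v : TangentSpace 𝓘(ℝ, E) x) :
    EndT E x :=
  homCov 𝓘(ℝ, E) cov cov id id S x v

/-- The field `S` of endomorphisms of the tangent bundle of `M` is smooth at `x`. -/
def SmoothEndAt (S : ∀ y : M, EndT E y) (x : M) : Prop :=
  ContMDiffAt 𝓘(ℝ, E) (endModel E) ∞ (fun y => (⟨y, S y⟩ : EndTotal E M)) x

/-- `R` is the curvature tensor of `cov` at `x`: `R X Y Z = ∇_X ∇_Y Z - ∇_Y ∇_X Z - ∇_[X, Y] Z` at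
`x`, for all smooth vector fields `X`, `Y`, `Z`. -/
def IsCurvatureAt (cov : Connection E M) (x : M)
    (R : TangentSpace 𝓘(ℝ, E) x →ₗ[ℝ] TangentSpace 𝓘(ℝ, E) x →ₗ[ℝ]
      TangentSpace 𝓘(ℝ, E) x →ₗ[ℝ] TangentSpace 𝓘(ℝ, E) x) : Prop :=
  ∀ X Y Z : ∀ y : M, TangentSpace 𝓘(ℝ, E) y,
    ContMDiff 𝓘(ℝ, E) (𝓘(ℝ, E).prod 𝓘(ℝ, E)) ∞ (fun y => TotalSpace.mk' E y (X y)) →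
    ContMDiff 𝓘(ℝ, E) (𝓘(ℝ, E).prod 𝓘(ℝ, E)) ∞ (fun y => TotalSpace.mk' E y (Y y)) →
    ContMDiff 𝓘(ℝ, E) (𝓘(ℝ, E).prod 𝓘(ℝ, E)) ∞ (fun y => TotalSpace.mk' E y (Z y)) →
    R (X x) (Y x) (Z x) =
      cov (fun y => cov Z y (Y y)) x (X x) - cov (fun y => cov Z y (X y)) x (Y x)
        - cov Z x (VectorField.mlieBracket 𝓘(ℝ, E) X Y x)

theorem homCov_add (covM : Connection E M) (covN : Connection E' N) (f : M → M) (g : M → N)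
    (h : ∀ b, TangentSpace 𝓘(ℝ, E) (f b) →L[ℝ] TangentSpace 𝓘(ℝ, E') (g b))
    (b : M) (v v' : TangentSpace 𝓘(ℝ, E) b) :
    homCov 𝓘(ℝ, E) covM covN f g h b (v + v') =
      homCov 𝓘(ℝ, E) covM covN f g h b v + homCov 𝓘(ℝ, E) covM covN f g h b v' := by
  unfold homCov
  rw [(homCoordDeriv 𝓘(ℝ, E) f g h b).map_add, map_add, map_add, christoffel_add, christoffel_add,
    ContinuousLinearMap.add_comp, ContinuousLinearMap.comp_add]
  have key : ∀ a a' p p' q q' : TangentSpace 𝓘(ℝ, E) (f b) →L[ℝ] TangentSpace 𝓘(ℝ, E') (g b),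
      a + a' + (p + p') - (q + q') = a + p - q + (a' + p' - q') := by intros; abel
  exact key _ _ _ _ _ _

theorem homCov_smul (covM : Connection E M) (covN : Connection E' N) (f : M → M) (g : M → N)
    (h : ∀ b, TangentSpace 𝓘(ℝ, E) (f b) →L[ℝ] TangentSpace 𝓘(ℝ, E') (g b))
    (b : M) (c : ℝ) (v : TangentSpace 𝓘(ℝ, E) b) :
    homCov 𝓘(ℝ, E) covM covN f g h b (c • v) = c • homCov 𝓘(ℝ, E) covM covN f g h b v := by
  unfold homCov
  rw [(homCoordDeriv 𝓘(ℝ, E) f g h b).map_smul, map_smul, map_smul, christoffel_smul,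
    christoffel_smul, ContinuousLinearMap.smul_comp, ContinuousLinearMap.comp_smul, smul_sub,
    smul_add]
  rfl

/-- The second fundamental form `∇dφ` of `φ` at `x`, as a bilinear map: `∇dφ(X, Y) = (∇_X dφ)(Y)`,
where `∇` is the connection induced on `Hom(TM, φ^*(TN))`. -/
def secondFundamentalForm (covM : Connection E M) (covN : Connection E' N) (φ : M → N) (x : M) :
    TangentSpace 𝓘(ℝ, E) x →ₗ[ℝ] TangentSpace 𝓘(ℝ, E) x →ₗ[ℝ] TangentSpace 𝓘(ℝ, E') (φ x) :=
  LinearMap.mk₂ ℝ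
    (fun X Y => homCov 𝓘(ℝ, E) covM covN id φ (fun y => mfderiv 𝓘(ℝ, E) 𝓘(ℝ, E') φ y) x X Y)
    (fun X X' Y => by rw [homCov_add]; rfl)
    (fun c X Y => by rw [homCov_smul]; rfl)
    (fun X Y Y' => map_add _ Y Y') (fun c X Y => map_smul _ c Y)

end Connections

/-! ## Quaternionic manifolds -/

/-- An almost quaternionic structure on `M`, given by the bundle `Q_M ⊆ End(TM)` which it
determines: a rank three subbundle locally spanned by smooth frames `I, J, K` satisfying the
quaternionic identities. Such frames are the positive orthonormal frames of `Q_M`. -/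
structure AlmostQuaternionicStructure (E : Type*) [NormedAddCommGroup E] [NormedSpace ℝ E]
    [FiniteDimensional ℝ E] (M : Type*) [TopologicalSpace M] [ChartedSpace E M]
    [IsManifold 𝓘(ℝ, E) ∞ M] where
  /-- The fibres of `Q_M`. -/
  Q : ∀ x : M, Submodule ℝ (EndT E x)
  exists_frame : ∀ x : M, ∃ (U : Set M) (I J K : ∀ y : M, EndT E y), IsOpen U ∧ x ∈ U ∧
    (∀ y ∈ U, SmoothEndAt I y ∧ SmoothEndAt J y ∧ SmoothEndAt K y) ∧
    ∀ y ∈ U, IsQuaternionicTriple (I y) (J y) (K y) ∧ Q y = Submodule.span ℝ {I y, J y, K y}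

section AlmostQuaternionic

variable {E : Type*} [NormedAddCommGroup E] [NormedSpace ℝ E] [FiniteDimensional ℝ E]
  {M : Type*} [TopologicalSpace M] [ChartedSpace E M] [IsManifold 𝓘(ℝ, E) ∞ M]

/-- The connection `∇` is an almost quaternionic connection, that is, it induces a connection on
`Q_M`: the covariant derivatives of the local sections of `Q_M` are sections of `Q_M`. -/
def IsAlmostQuaternionicConnection (A : AlmostQuaternionicStructure E M) (cov : Connection E M) :
    Prop :=
  ∀ (x : M) (S : ∀ y : M, EndT E y), SmoothEndAt S x → (∀ᶠ y in 𝓝 x, S y ∈ A.Q y) →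
    ∀ v : TangentSpace 𝓘(ℝ, E) x, endCov cov S x v ∈ A.Q x

/-- Anti-self-duality in dimension four. There, an almost quaternionic structure is the same as an
oriented conformal structure, with `Q_M` the bundle of self-dual two-forms, and the torsion-free
almost quaternionic connections are the Weyl connections. For `u ≠ 0`, the self-dual bivector
`u ∧ Iu + Ju ∧ Ku` corresponds to `I`, up to a factor depending only on `u`, and the component
along `J` of the curvature endomorphism `R (u ∧ Iu + Ju ∧ Ku)` is a fixed multiple of the trace of
`J ∘ R (u ∧ Iu + Ju ∧ Ku)`. These components form a bilinear form on `(Q_M)_x` whose trace-free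
symmetric part is the self-dual part of the Weyl tensor; the latter is required to vanish, that is,
the symmetrized component along any two orthogonal unit elements `I`, `J` of `(Q_M)_x` is zero. -/
def IsAntiSelfDual (A : AlmostQuaternionicStructure E M) (cov : Connection E M) : Prop :=
  ∀ x : M, ∃ R : TangentSpace 𝓘(ℝ, E) x →ₗ[ℝ] TangentSpace 𝓘(ℝ, E) x →ₗ[ℝ]
      TangentSpace 𝓘(ℝ, E) x →ₗ[ℝ] TangentSpace 𝓘(ℝ, E) x, IsCurvatureAt cov x R ∧
    ∀ I ∈ A.Q x, ∀ J ∈ A.Q x, ∀ K ∈ A.Q x, IsQuaternionicTriple I J K →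
      ∀ u : TangentSpace 𝓘(ℝ, E) x,
        LinearMap.trace ℝ (TangentSpace 𝓘(ℝ, E) x)
            ((J : TangentSpace 𝓘(ℝ, E) x →ₗ[ℝ] TangentSpace 𝓘(ℝ, E) x) ∘ₗ
              (R u (I u) + R (J u) (K u)))
          + LinearMap.trace ℝ (TangentSpace 𝓘(ℝ, E) x)
            ((I : TangentSpace 𝓘(ℝ, E) x →ₗ[ℝ] TangentSpace 𝓘(ℝ, E) x) ∘ₗ
              (R u (J u) + R (K u) (I u))) = 0

end AlmostQuaternionic

/-- A quaternionic manifold structure on `M`: an almost quaternionic structure together with a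
quaternionic connection, that is, a torsion-free almost quaternionic connection which, if
`dim M = 4`, is moreover an anti-self-dual Weyl connection. -/
structure QuaternionicStructure (E : Type*) [NormedAddCommGroup E] [NormedSpace ℝ E]
    [FiniteDimensional ℝ E] (M : Type*) [TopologicalSpace M] [ChartedSpace E M]
    [IsManifold 𝓘(ℝ, E) ∞ M] extends AlmostQuaternionicStructure E M where
  /-- The quaternionic connection. -/
  cov : Connection E M
  smooth_cov : CovariantDerivative.ContMDiffCovariantDerivative cov ∞
  almostQuaternionic : IsAlmostQuaternionicConnection toAlmostQuaternionicStructure cov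
  torsion_eq_zero : haveI := FiniteDimensional.complete ℝ E; cov.torsion = 0
  antiSelfDual : Module.finrank ℝ E = 4 → IsAntiSelfDual toAlmostQuaternionicStructure cov

/-! ## The twistor space -/

section Twistor

variable {E : Type*} [NormedAddCommGroup E] [NormedSpace ℝ E] [FiniteDimensional ℝ E]
  {M : Type*} [TopologicalSpace M] [ChartedSpace E M] [IsManifold 𝓘(ℝ, E) ∞ M]
  {E' : Type*} [NormedAddCommGroup E'] [NormedSpace ℝ E'] [FiniteDimensional ℝ E']
  {N : Type*} [TopologicalSpace N] [ChartedSpace E' N] [IsManifold 𝓘(ℝ, E') ∞ N]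

/-- The fibre `(Z_M)_x`, that is, the unit sphere of `(Q_M)_x`: as `(aI + bJ + cK)²` is
`-(a² + b² + c²)`, it is formed of the elements of `(Q_M)_x` which are complex structures. -/
abbrev AlmostQuaternionicStructure.Z (A : AlmostQuaternionicStructure E M) (x : M) : Type _ :=
  {J : EndT E x // J ∈ A.Q x ∧ J * J = -1}

/-- The sphere bundle `Z_M`, formed of the pairs `(x, J)` with `J ∈ (Z_M)_x`. -/
abbrev AlmostQuaternionicStructure.TwistorSpace (A : AlmostQuaternionicStructure E M) : Type _ :=
  Σ x : M, A.Z x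

/-- The inclusion of `Z_M`, as an embedded submanifold, in the total space of `End(TM)`. -/
def AlmostQuaternionicStructure.incl (A : AlmostQuaternionicStructure E M) (p : A.TwistorSpace) :
    EndTotal E M :=
  ⟨p.1, p.2.1⟩

/-- The curve `c` in `Z_M` is smooth at `0`. -/
def SmoothCurveAt (A : AlmostQuaternionicStructure E M) (c : ℝ → A.TwistorSpace) : Prop :=
  ContMDiffAt 𝓘(ℝ, ℝ) (endModel E) ∞ (fun t => A.incl (c t)) 0

/-- The velocity at `0` of the curve `c` in `Z_M`, as a tangent vector to `End(TM)`. -/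
def velocity (A : AlmostQuaternionicStructure E M) (c : ℝ → A.TwistorSpace) :
    TangentBundle (endModel E) (EndTotal E M) :=
  tangentMap 𝓘(ℝ, ℝ) (endModel E) (fun t => A.incl (c t)) ⟨0, (1 : ℝ)⟩

/-- A map `Z_M → Z_N` which covers `φ : M → N` is a family `Φ` of maps `(Z_M)_x → (Z_N)_{φ x}`;
this is the corresponding map between the total spaces. -/
abbrev totalLift {A : AlmostQuaternionicStructure E M} {A' : AlmostQuaternionicStructure E' N}
    (φ : M → N) (Φ : ∀ x : M, A.Z x → A'.Z (φ x)) (p : A.TwistorSpace) : A'.TwistorSpace :=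
  ⟨φ p.1, Φ p.1 p.2⟩

/-- `F : Z_M → Z_N` is smooth, as a map between embedded submanifolds: locally, it is the
restriction of smooth maps from open sets of `End(TM)` to `End(TN)`. -/
def SmoothTwistorMap {A : AlmostQuaternionicStructure E M}
    {A' : AlmostQuaternionicStructure E' N} (F : A.TwistorSpace → A'.TwistorSpace) : Prop :=
  ∀ p : A.TwistorSpace, ∃ (U : Set (EndTotal E M)) (G : EndTotal E M → EndTotal E' N),
    IsOpen U ∧ A.incl p ∈ U ∧ ContMDiffOn (endModel E) (endModel E') ∞ G U ∧
      ∀ q : A.TwistorSpace, A.incl q ∈ U → G (A.incl q) = A'.incl (F q)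

/-- `dF_p(ξ) = ξ'`, where `F : Z_M → Z_N` is smooth, `ξ` is tangent to `Z_M` at `p`, and `ξ'` is
tangent to `Z_N` at `F p`: there is a smooth curve in `Z_M` with velocity `ξ` (this says that `ξ`
is tangent to `Z_M`) which is mapped by `F` onto a curve with velocity `ξ'`. -/
def IsPushforward {A : AlmostQuaternionicStructure E M}
    {A' : AlmostQuaternionicStructure E' N} (F : A.TwistorSpace → A'.TwistorSpace)
    (p : A.TwistorSpace) (ξ : TangentSpace (endModel E) (A.incl p))
    (ξ' : TangentSpace (endModel E') (A'.incl (F p))) : Prop :=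
  ∃ c : ℝ → A.TwistorSpace, SmoothCurveAt A c ∧ velocity A c = ⟨A.incl p, ξ⟩ ∧
    velocity A' (fun t => F (c t)) = ⟨A'.incl (F p), ξ'⟩

/-- The vertical component, in `End(T_x M)`, of a vector tangent to the manifold `End(TM)`, with
respect to the splitting `ℋ ⊕ ker dπ` determined by the connection `cov`; it is the covariant
derivative of the tautological section of the pull-back of `End(TM)` to its own total space. The
kernel of `verticalPart` is the horizontal distribution `ℋ`. -/
def verticalPart (cov : Connection E M) (p : EndTotal E M) (ξ : TangentSpace (endModel E) p) :
    EndT E p.proj :=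
  homCov (endModel E) cov cov (fun q : EndTotal E M => q.proj) (fun q : EndTotal E M => q.proj)
    (fun q => q.2) p ξ

/-- The projection `dπ` of a vector tangent to the manifold `End(TM)`. -/
def horizontalPart (p : EndTotal E M) (ξ : TangentSpace (endModel E) p) :
    TangentSpace 𝓘(ℝ, E) p.proj :=
  mfderiv (endModel E) 𝓘(ℝ, E) (fun q : EndTotal E M => q.proj) p ξ

/-- `𝓙_M ξ = η`, for `ξ` and `η` tangent to `Z_M` at `(x, J)`, where `𝓙_M` is the almost complex
structure on `Z_M` which preserves both `ℋ` and `ker dπ`, acts on `ℋ = T_x M` as `J`, and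
acts on `ker dπ`, the tangent plane to the sphere `(Z_M)_x` at `J`, as the composition with `J`
to the left. -/
def IsTwistorImage (A : QuaternionicStructure E M) (p : A.TwistorSpace)
    (ξ η : TangentSpace (endModel E) (A.incl p)) : Prop :=
  horizontalPart (A.incl p) η = p.2.1 (horizontalPart (A.incl p) ξ) ∧
    verticalPart A.cov (A.incl p) η = p.2.1 ∘L verticalPart A.cov (A.incl p) ξ

/-- The map `φ` is twistorial, with respect to `Φ`, for the twistorial structures of the
quaternionic manifolds `M` and `N`: `Φ : (Z_M, 𝓙_M) → (Z_N, 𝓙_N)` is holomorphic, that is, smooth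
with differential intertwining `𝓙_M` and `𝓙_N`. -/
def IsTwistorial (A : QuaternionicStructure E M) (A' : QuaternionicStructure E' N)
    (φ : M → N) (Φ : ∀ x : M, A.Z x → A'.Z (φ x)) : Prop :=
  SmoothTwistorMap (totalLift φ Φ) ∧
    ∀ (p : A.TwistorSpace) (ξ η : TangentSpace (endModel E) (A.incl p))
      (ξ' η' : TangentSpace (endModel E') (A'.incl (totalLift φ Φ p))),
      IsPushforward (totalLift φ Φ) p ξ ξ' → IsPushforward (totalLift φ Φ) p η η' →
        IsTwistorImage A p ξ η → IsTwistorImage A' (totalLift φ Φ p) ξ' η'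

/-! ## Quaternionic maps -/

/-- `φ : M → N` is a quaternionic map with respect to `Φ : Z_M → Z_N`; both maps are smooth. -/
structure IsQuaternionicMap (A : AlmostQuaternionicStructure E M)
    (A' : AlmostQuaternionicStructure E' N) (φ : M → N) (Φ : ∀ x : M, A.Z x → A'.Z (φ x)) :
    Prop where
  smooth : ContMDiff 𝓘(ℝ, E) 𝓘(ℝ, E') ∞ φ
  smooth_lift : SmoothTwistorMap (totalLift φ Φ)
  comm : ∀ (x : M) (J : A.Z x),
    mfderiv 𝓘(ℝ, E) 𝓘(ℝ, E') φ x ∘L J.1 = (Φ x J).1 ∘L mfderiv 𝓘(ℝ, E) 𝓘(ℝ, E') φ x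

/-- A nonzero element of `(Q_M)_x` is injective. -/
theorem AlmostQuaternionicStructure.eq_zero_of_apply_eq_zero
    (A : AlmostQuaternionicStructure E M) {x : M} {q : EndT E x} (hq : q ∈ A.Q x)
    {u : TangentSpace 𝓘(ℝ, E) x} (hu : u ≠ 0) (h : q u = 0) : q = 0 := by
  obtain ⟨U, I, J, K, -, hxU, -, hU⟩ := A.exists_frame x
  obtain ⟨hT, hQ⟩ := hU x hxU
  rw [hQ, Submodule.mem_span_triple] at hq
  obtain ⟨a, b, c, rfl⟩ := hq
  have h2 := congrArg (fun f : EndT E x => f u) (hT.mul_self a b c)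
  have h3 : (a ^ 2 + b ^ 2 + c ^ 2) • u = 0 := by
    have : (0 : TangentSpace 𝓘(ℝ, E) x) = -((a ^ 2 + b ^ 2 + c ^ 2) • u) := by
      rw [← map_zero (a • I x + b • J x + c • K x), ← h]
      exact h2
    rw [← neg_eq_zero, ← this]
  have h4 : a ^ 2 + b ^ 2 + c ^ 2 = 0 := (smul_eq_zero.1 h3).resolve_right hu
  have ha : a = 0 := by nlinarith [sq_nonneg a, sq_nonneg b, sq_nonneg c]
  have hb : b = 0 := by nlinarith [sq_nonneg a, sq_nonneg b, sq_nonneg c]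
  have hc : c = 0 := by nlinarith [sq_nonneg a, sq_nonneg b, sq_nonneg c]
  simp [ha, hb, hc]

/-- At a point where the differential of the quaternionic map `φ` is nonzero, `Φ` extends to a
linear map from `(Q_M)_x` to `(Q_N)_{φ x}`. -/
theorem IsQuaternionicMap.exists_linear_extension {A : AlmostQuaternionicStructure E M}
    {A' : AlmostQuaternionicStructure E' N} {φ : M → N} {Φ : ∀ x : M, A.Z x → A'.Z (φ x)}
    (h : IsQuaternionicMap A A' φ Φ) {x : M} (hx : mfderiv 𝓘(ℝ, E) 𝓘(ℝ, E') φ x ≠ 0) :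
    ∃ L : A.Q x →ₗ[ℝ] A'.Q (φ x), ∀ J : A.Z x, (L ⟨J.1, J.2.1⟩ : EndT E' (φ x)) = (Φ x J).1 := by
  obtain ⟨u, hu⟩ : ∃ u, mfderiv 𝓘(ℝ, E) 𝓘(ℝ, E') φ x u ≠ 0 := by
    by_contra! hc
    exact hx (ContinuousLinearMap.ext hc)
  let e : A.Q x →ₗ[ℝ] TangentSpace 𝓘(ℝ, E') (φ x) :=
    { toFun := fun q => mfderiv 𝓘(ℝ, E) 𝓘(ℝ, E') φ x (q.1 u)
      map_add' := fun q q' => map_add (mfderiv 𝓘(ℝ, E) 𝓘(ℝ, E') φ x) (q.1 u) (q'.1 u)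
      map_smul' := fun r q => map_smul (mfderiv 𝓘(ℝ, E) 𝓘(ℝ, E') φ x) r (q.1 u) }
  let e' : A'.Q (φ x) →ₗ[ℝ] TangentSpace 𝓘(ℝ, E') (φ x) :=
    { toFun := fun q => q.1 (mfderiv 𝓘(ℝ, E) 𝓘(ℝ, E') φ x u)
      map_add' := fun q q' => rfl
      map_smul' := fun r q => rfl }
  have he' : Function.Injective e' := by
    rw [injective_iff_map_eq_zero]
    intro q hq
    exact Subtype.ext (A'.eq_zero_of_apply_eq_zero q.2 hu hq)
  have hZ : ∀ J : A.Z x, e ⟨J.1, J.2.1⟩ = e' ⟨(Φ x J).1, (Φ x J).2.1⟩ := fun J =>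
    congrArg (fun f : TangentSpace 𝓘(ℝ, E) x →L[ℝ] TangentSpace 𝓘(ℝ, E') (φ x) => f u) (h.comm x J)
  have hr : ∀ q : A.Q x, e q ∈ LinearMap.range e' := by
    obtain ⟨U, I, J, K, -, hxU, -, hU⟩ := A.exists_frame x
    obtain ⟨hT, hQ⟩ := hU x hxU
    have hI : I x ∈ A.Q x := by rw [hQ]; exact Submodule.subset_span (by simp)
    have hJ : J x ∈ A.Q x := by rw [hQ]; exact Submodule.subset_span (by simp)
    have hK : K x ∈ A.Q x := by rw [hQ]; exact Submodule.subset_span (by simp)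
    rintro ⟨q, hq⟩
    have hq' := hq
    rw [hQ, Submodule.mem_span_triple] at hq'
    obtain ⟨a, b, c, rfl⟩ := hq'
    have : (⟨a • I x + b • J x + c • K x, hq⟩ : A.Q x) =
        a • ⟨I x, hI⟩ + b • ⟨J x, hJ⟩ + c • ⟨K x, hK⟩ := rfl
    rw [this, map_add, map_add, map_smul, map_smul, map_smul]
    refine Submodule.add_mem _ (Submodule.add_mem _ ?_ ?_) ?_ <;> refine Submodule.smul_mem _ _ ?_
    · exact ⟨_, (hZ ⟨I x, hI, hT.1⟩).symm⟩
    · exact ⟨_, (hZ ⟨J x, hJ, hT.2.1⟩).symm⟩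
    · exact ⟨_, (hZ ⟨K x, hK, hT.2.2.1⟩).symm⟩
  refine ⟨(LinearEquiv.ofInjective e' he').symm.toLinearMap ∘ₗ
    LinearMap.codRestrict (LinearMap.range e') e hr, fun J => ?_⟩
  have : (LinearEquiv.ofInjective e' he').symm
      (LinearMap.codRestrict (LinearMap.range e') e hr ⟨J.1, J.2.1⟩) =
        ⟨(Φ x J).1, (Φ x J).2.1⟩ := by
    rw [LinearEquiv.symm_apply_eq]
    exact Subtype.ext (hZ J)
  exact congrArg Subtype.val this

/-- The isomorphism `Q_M = φ^*(Q_N)` determined by a quaternionic map `φ` of rank at least one: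
the (unique) linear extension of `Φ : (Z_M)_x → (Z_N)_{φ x}` to `(Q_M)_x`. -/
def IsQuaternionicMap.qMap {A : AlmostQuaternionicStructure E M}
    {A' : AlmostQuaternionicStructure E' N} {φ : M → N} {Φ : ∀ x : M, A.Z x → A'.Z (φ x)}
    (h : IsQuaternionicMap A A' φ Φ) (hφ : ∀ x, mfderiv 𝓘(ℝ, E) 𝓘(ℝ, E') φ x ≠ 0) (x : M) :
    A.Q x →ₗ[ℝ] A'.Q (φ x) :=
  (h.exists_linear_extension (hφ x)).choose

/-- Let `φ` be a quaternionic map of rank at least one, and let `S` be a section of `Z_M`, smooth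
near `x`. This is `A(X)S = ∇^N_X S - ∇^M_X S` at `x`, where `A` is the difference between the
connections, on `Q_M = φ^*(Q_N)`, induced by the connections of `M` and `N`. The result is written
as an element of `(φ^*(Q_N))_x`; it depends only on `X` and `S x`. -/
def connectionDifference {A : QuaternionicStructure E M} {A' : QuaternionicStructure E' N}
    {φ : M → N} {Φ : ∀ x : M, A.Z x → A'.Z (φ x)}
    (h : IsQuaternionicMap A.toAlmostQuaternionicStructure A'.toAlmostQuaternionicStructure φ Φ)
    (hφ : ∀ x, mfderiv 𝓘(ℝ, E) 𝓘(ℝ, E') φ x ≠ 0) {x : M} (S : ∀ y : M, A.Z y)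
    (hS : SmoothEndAt (fun y => (S y).1) x) (X : TangentSpace 𝓘(ℝ, E) x) : EndT E' (φ x) :=
  homCov 𝓘(ℝ, E) A'.cov A'.cov φ φ (fun y => (Φ y (S y)).1) x X
    - (h.qMap hφ x ⟨endCov A.cov (fun y => (S y).1) x X,
        A.almostQuaternionic x _ hS (Filter.Eventually.of_forall fun y => (S y).2.1) X⟩).1

/-- `T^{0,1;J}`: the eigenspace of `J` with respect to `-i`, in the complexification. -/
def T01 {x : M} (J : EndT E x) : Submodule ℂ (ℂ ⊗[ℝ] TangentSpace 𝓘(ℝ, E) x) :=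
  Module.End.eigenspace
    ((J : TangentSpace 𝓘(ℝ, E) x →ₗ[ℝ] TangentSpace 𝓘(ℝ, E) x).baseChange ℂ) (-Complex.I)

end Twistor

end

/-! Write `B = ∇dφ`. Each of the three assertions is equivalent to one pointwise real identity,
`B(JX, JY) = B(X, Y) + Φ(J)(B(JX, Y) + B(X, JY))` for all `J` in `Z_M`, recorded as
`TwistorialForm`.

The link is obtained by differentiating `dφ ∘ J = Φ(J) ∘ dφ` along a map into `Z_M`
(`homCov_lift_comp`): if the base point moves with velocity `X`, then `(∇Φ(J))(dφ w) + Φ(J) B(X, w)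
= B(X, Jw) + dφ((∇J) w)`. Hence `dΦ` sends a horizontal vector over `X` to a vector whose vertical
component `V'` satisfies `V'(dφ w) = B(X, Jw) - Φ(J) B(X, w)`. The horizontal components always
match, and comparing `V'` for `X` and for `JX` gives the identity (`isTwistorial_iff`). The element
`A(X)J` takes the same value on `dφ w`, which settles (iii) (`connectionDifference_iff`). For (ii),
`T^{0,1}` consists of the vectors `X + iJX`, and separating real and imaginary parts yields the
identity again (`baseChange_mem_eigenspace_iff`).

To return from the identity to (i) or (iii), an equality of endomorphisms must follow from its
values on the image of `dφ`. All the elements involved lie in `ℝ ⊕ Q_N`, a copy of the quaternions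
when `N` has positive dimension, so one vector `dφ w ≠ 0` suffices (`eq_mul_of_apply_eq`). This
needs `∇Φ(J)` to lie in `Q_N` although `Φ(J)` is only a section along a map (`homCov_mem`). To go
from (i) to the identity, every `X` must have a horizontal lift realised by a curve in `Z_M`
(`exists_horizontal_curve`). The calculus rests on the Leibniz rule `homCov_comp` and on naturality
under pull-back, `homCov_pullback`. -/

noncomputable section

set_option linter.unusedSectionVars false

/-! ## Bilinear operations and derivatives on manifolds -/

section BilinearDeriv

variable {EB : Type*} [NormedAddCommGroup EB] [NormedSpace ℝ EB] {HB : Type*} [TopologicalSpace HB]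
  {IB : ModelWithCorners ℝ EB HB} {B : Type*} [TopologicalSpace B] [ChartedSpace HB B]
  {F₁ F₂ F₃ : Type*} [NormedAddCommGroup F₁] [NormedSpace ℝ F₁] [NormedAddCommGroup F₂]
  [NormedSpace ℝ F₂] [NormedAddCommGroup F₃] [NormedSpace ℝ F₃]

/-- The differential of a map into a vector space, with values in that vector space. -/
def vderiv (IB : ModelWithCorners ℝ EB HB) (u : B → F₁) (b : B) : TangentSpace IB b →L[ℝ] F₁ :=
  mfderiv IB 𝓘(ℝ, F₁) u b

theorem vderiv_congr {u u' : B → F₁} {b : B} (h : u =ᶠ[𝓝 b] u') :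
    vderiv IB u b = vderiv IB u' b := h.mfderiv_eq

theorem mdifferentiableAt_bilin (L : F₁ →L[ℝ] F₂ →L[ℝ] F₃) {u : B → F₁} {w : B → F₂} {b : B}
    (hu : MDifferentiableAt IB 𝓘(ℝ, F₁) u b) (hw : MDifferentiableAt IB 𝓘(ℝ, F₂) w b) :
    MDifferentiableAt IB 𝓘(ℝ, F₃) (fun b => L (u b) (w b)) b :=
  (L.isBoundedBilinearMap.differentiableAt (u b, w b)).mdifferentiableAt.comp
    (f := fun b => (u b, w b)) b (hu.prodMk_space hw)

theorem vderiv_bilin (L : F₁ →L[ℝ] F₂ →L[ℝ] F₃) {u : B → F₁} {w : B → F₂} {b : B}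
    (hu : MDifferentiableAt IB 𝓘(ℝ, F₁) u b) (hw : MDifferentiableAt IB 𝓘(ℝ, F₂) w b)
    (v : TangentSpace IB b) :
    vderiv IB (fun b => L (u b) (w b)) b v = L (vderiv IB u b v) (w b) + L (u b) (vderiv IB w b v) := by
  have h := ((L.isBoundedBilinearMap.hasFDerivAt (u b, w b)).hasMFDerivAt).comp
    (f := fun b => (u b, w b)) b
    (f' := (vderiv IB u b).prod (vderiv IB w b))
    ⟨hu.continuousAt.prodMk hw.continuousAt, hu.hasMFDerivAt.2.prodMk hw.hasMFDerivAt.2⟩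
  have h2 := congrArg (fun l : TangentSpace IB b →L[ℝ] F₃ => l v) h.mfderiv
  refine Eq.trans h2 ?_
  -- The derivative of a bounded bilinear map lists first the term in which the second argument
  -- varies.
  exact add_comm _ _

theorem vderiv_add {u w : B → F₁} {b : B}
    (hu : MDifferentiableAt IB 𝓘(ℝ, F₁) u b) (hw : MDifferentiableAt IB 𝓘(ℝ, F₁) w b)
    (v : TangentSpace IB b) :
    vderiv IB (fun b => u b + w b) b v = vderiv IB u b v + vderiv IB w b v :=
  congrArg (fun l : TangentSpace IB b →L[ℝ] F₁ => l v)
    (hu.hasMFDerivAt.add hw.hasMFDerivAt).mfderiv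

theorem vderiv_const (c : F₁) (b : B) : vderiv IB (fun _ => c) b = 0 := mfderiv_const

end BilinearDeriv

/-! ## Calculus for the induced connections -/

section Calculus

variable {E : Type*} [NormedAddCommGroup E] [NormedSpace ℝ E] [FiniteDimensional ℝ E]
  {M : Type*} [TopologicalSpace M] [ChartedSpace E M] [IsManifold 𝓘(ℝ, E) ∞ M]
  {E' : Type*} [NormedAddCommGroup E'] [NormedSpace ℝ E'] [FiniteDimensional ℝ E']
  {N : Type*} [TopologicalSpace N] [ChartedSpace E' N] [IsManifold 𝓘(ℝ, E') ∞ N]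
  {E'' : Type*} [NormedAddCommGroup E''] [NormedSpace ℝ E''] [FiniteDimensional ℝ E'']
  {P : Type*} [TopologicalSpace P] [ChartedSpace E'' P] [IsManifold 𝓘(ℝ, E'') ∞ P]
  {EB : Type*} [NormedAddCommGroup EB] [NormedSpace ℝ EB] {HB : Type*} [TopologicalSpace HB]
  {IB : ModelWithCorners ℝ EB HB} {B : Type*} [TopologicalSpace B] [ChartedSpace HB B]
  {EC : Type*} [NormedAddCommGroup EC] [NormedSpace ℝ EC] {HC : Type*} [TopologicalSpace HC]
  {IC : ModelWithCorners ℝ EC HC} {C : Type*} [TopologicalSpace C] [ChartedSpace HC C]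

/-- The coordinates of a section `h` of `Hom(f^*(TM), g^*(TN))` in the preferred charts at the
images of `b`. -/
def homCoord (f : B → M) (g : B → N)
    (h : ∀ b, TangentSpace 𝓘(ℝ, E) (f b) →L[ℝ] TangentSpace 𝓘(ℝ, E') (g b)) (b b' : B) :
    E →L[ℝ] E' :=
  inTangentCoordinates 𝓘(ℝ, E) 𝓘(ℝ, E') f g h b b'

theorem homCoord_eq (f : B → M) (g : B → N)
    (h : ∀ b, TangentSpace 𝓘(ℝ, E) (f b) →L[ℝ] TangentSpace 𝓘(ℝ, E') (g b)) (b b' : B) :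
    homCoord f g h b b' =
      (trivializationAt E' (TangentSpace 𝓘(ℝ, E') : N → Type _) (g b)).continuousLinearMapAt ℝ (g b')
        ∘L h b' ∘L
          (trivializationAt E (TangentSpace 𝓘(ℝ, E) : M → Type _) (f b)).symmL ℝ (f b') :=
  rfl

/-- The preferred trivialization at a point is the identity on the fibre over that point, being the
coordinate change of a chart with itself. So at `b` the matrix can be replaced by `h b` in the
product rules. -/
theorem homCoord_self (f : B → M) (g : B → N)
    (h : ∀ b, TangentSpace 𝓘(ℝ, E) (f b) →L[ℝ] TangentSpace 𝓘(ℝ, E') (g b)) (b : B) :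
    homCoord f g h b b = h b := by
  refine (inTangentCoordinates_eq (I := 𝓘(ℝ, E)) (I' := 𝓘(ℝ, E')) f g h
    (mem_chart_source _ _) (mem_chart_source _ _)).trans ?_
  refine ContinuousLinearMap.ext fun w => ?_
  refine ((tangentBundleCore 𝓘(ℝ, E') N).coordChange_self _ _ (mem_chart_source _ _) _).trans ?_
  exact congrArg (h b) ((tangentBundleCore 𝓘(ℝ, E) M).coordChange_self _ _ (mem_chart_source _ _) w)

/-- The trivialization at `g b` cancels against its inverse only over its base set, which `g`
reaches near `b` by continuity; a germ identity is enough for derivatives. -/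
theorem homCoord_comp {f : B → M} {g : B → N} {k : B → P}
    (h₁ : ∀ b, TangentSpace 𝓘(ℝ, E) (f b) →L[ℝ] TangentSpace 𝓘(ℝ, E') (g b))
    (h₂ : ∀ b, TangentSpace 𝓘(ℝ, E') (g b) →L[ℝ] TangentSpace 𝓘(ℝ, E'') (k b)) {b : B}
    (hg : ContinuousAt g b) :
    (fun b' => homCoord f k (fun b => h₂ b ∘L h₁ b) b b') =ᶠ[𝓝 b]
      fun b' => homCoord g k h₂ b b' ∘L homCoord f g h₁ b b' := by
  have hx := FiberBundle.mem_baseSet_trivializationAt E' (TangentSpace 𝓘(ℝ, E') : N → Type _) (g b)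
  filter_upwards [hg ((trivializationAt E' (TangentSpace 𝓘(ℝ, E') : N → Type _)
    (g b)).open_baseSet.mem_nhds hx)] with b' hb'
  ext w
  simp only [homCoord_eq, ContinuousLinearMap.comp_apply]
  erw [Trivialization.symmL_continuousLinearMapAt _ hb']

theorem homCoord_id {f : B → M} {b : B} (hf : ContinuousAt f b) :
    (fun b' => homCoord f f (fun b => ContinuousLinearMap.id ℝ (TangentSpace 𝓘(ℝ, E) (f b))) b b')
      =ᶠ[𝓝 b] fun _ => ContinuousLinearMap.id ℝ E := by
  have hx := FiberBundle.mem_baseSet_trivializationAt E (TangentSpace 𝓘(ℝ, E) : M → Type _) (f b)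
  filter_upwards [hf ((trivializationAt E (TangentSpace 𝓘(ℝ, E) : M → Type _)
    (f b)).open_baseSet.mem_nhds hx)] with b' hb'
  ext w
  simp only [homCoord_eq, ContinuousLinearMap.comp_apply]
  exact Trivialization.continuousLinearMapAt_symmL _ hb' _

theorem homCoord_add (f : B → M) (g : B → N)
    (h k : ∀ b, TangentSpace 𝓘(ℝ, E) (f b) →L[ℝ] TangentSpace 𝓘(ℝ, E') (g b)) (b b' : B) :
    homCoord f g (fun b => h b + k b) b b' = homCoord f g h b b' + homCoord f g k b b' := by
  simp only [homCoord_eq]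
  ext w
  simp

theorem homCoord_smul (f : B → M) (g : B → N) (a : B → ℝ)
    (h : ∀ b, TangentSpace 𝓘(ℝ, E) (f b) →L[ℝ] TangentSpace 𝓘(ℝ, E') (g b)) (b b' : B) :
    homCoord f g (fun b => a b • h b) b b' = a b' • homCoord f g h b b' := by
  simp only [homCoord_eq]
  ext w
  simp

/-- The section `h` of `Hom(f^*(TM), g^*(TN))` is differentiable at `b`. -/
structure HomDiffAt (IB : ModelWithCorners ℝ EB HB) (f : B → M) (g : B → N)
    (h : ∀ b, TangentSpace 𝓘(ℝ, E) (f b) →L[ℝ] TangentSpace 𝓘(ℝ, E') (g b)) (b : B) : Prop where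
  source : MDifferentiableAt IB 𝓘(ℝ, E) f b
  target : MDifferentiableAt IB 𝓘(ℝ, E') g b
  coord : MDifferentiableAt IB 𝓘(ℝ, E →L[ℝ] E') (homCoord f g h b) b

theorem homCov_eq (covM : Connection E M) (covN : Connection E' N)
    (f : B → M) (g : B → N)
    (h : ∀ b, TangentSpace 𝓘(ℝ, E) (f b) →L[ℝ] TangentSpace 𝓘(ℝ, E') (g b))
    (b : B) (v : TangentSpace IB b) :
    homCov IB covM covN f g h b v =
      (show TangentSpace 𝓘(ℝ, E) (f b) →L[ℝ] TangentSpace 𝓘(ℝ, E') (g b) from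
        vderiv IB (homCoord f g h b) b v)
      + christoffel covN (g b) (mfderiv IB 𝓘(ℝ, E') g b v) ∘L h b
      - h b ∘L christoffel covM (f b) (mfderiv IB 𝓘(ℝ, E) f b v) := rfl

theorem homCov_congr (covM : Connection E M) (covN : Connection E' N) {f : B → M} {g : B → N}
    {h h' : ∀ b, TangentSpace 𝓘(ℝ, E) (f b) →L[ℝ] TangentSpace 𝓘(ℝ, E') (g b)} {b : B}
    (e : ∀ᶠ b' in 𝓝 b, h b' = h' b') (v : TangentSpace IB b) :
    homCov IB covM covN f g h b v = homCov IB covM covN f g h' b v := by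
  rw [homCov_eq, homCov_eq, e.self_of_nhds, vderiv_congr (u' := homCoord f g h' b)]
  exact e.mono fun b' hb' => by simp only [homCoord_eq, hb']

theorem HomDiffAt.comp {f : B → M} {g : B → N} {k : B → P}
    {h₁ : ∀ b, TangentSpace 𝓘(ℝ, E) (f b) →L[ℝ] TangentSpace 𝓘(ℝ, E') (g b)}
    {h₂ : ∀ b, TangentSpace 𝓘(ℝ, E') (g b) →L[ℝ] TangentSpace 𝓘(ℝ, E'') (k b)} {b : B}
    (hh₂ : HomDiffAt IB g k h₂ b) (hh₁ : HomDiffAt IB f g h₁ b) :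
    HomDiffAt IB f k (fun b => h₂ b ∘L h₁ b) b where
  source := hh₁.source
  target := hh₂.target
  coord := (mdifferentiableAt_bilin (ContinuousLinearMap.compL ℝ E E' E'')
    hh₂.coord hh₁.coord).congr_of_eventuallyEq (homCoord_comp h₁ h₂ hh₁.target.continuousAt)

/-- The Leibniz rule for compositions. -/
theorem homCov_comp (covM : Connection E M) (covN : Connection E' N) (covP : Connection E'' P)
    {f : B → M} {g : B → N} {k : B → P}
    {h₁ : ∀ b, TangentSpace 𝓘(ℝ, E) (f b) →L[ℝ] TangentSpace 𝓘(ℝ, E') (g b)}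
    {h₂ : ∀ b, TangentSpace 𝓘(ℝ, E') (g b) →L[ℝ] TangentSpace 𝓘(ℝ, E'') (k b)} {b : B}
    (hh₂ : HomDiffAt IB g k h₂ b) (hh₁ : HomDiffAt IB f g h₁ b) (v : TangentSpace IB b) :
    homCov IB covM covP f k (fun b => h₂ b ∘L h₁ b) b v =
      homCov IB covN covP g k h₂ b v ∘L h₁ b + h₂ b ∘L homCov IB covM covN f g h₁ b v := by
  have e : vderiv IB (homCoord f k (fun b => h₂ b ∘L h₁ b) b) b v =
      vderiv IB (homCoord g k h₂ b) b v ∘L homCoord f g h₁ b b +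
        homCoord g k h₂ b b ∘L vderiv IB (homCoord f g h₁ b) b v := by
    rw [vderiv_congr (homCoord_comp h₁ h₂ hh₁.target.continuousAt)]
    exact vderiv_bilin (ContinuousLinearMap.compL ℝ E E' E'') hh₂.coord hh₁.coord v
  rw [homCoord_self, homCoord_self] at e
  rw [homCov_eq, homCov_eq, homCov_eq, e]
  -- Tangent spaces unfold to the model spaces, so the algebra is done there. The two terms
  -- containing the connection form `γg` of the middle bundle cancel.
  have key : ∀ (d₂ a₂ : E' →L[ℝ] E'') (d₁ a₁ : E →L[ℝ] E') (γf : E →L[ℝ] E) (γg : E' →L[ℝ] E')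
      (γk : E'' →L[ℝ] E''),
      (d₂ ∘L a₁ + a₂ ∘L d₁) + γk ∘L (a₂ ∘L a₁) - (a₂ ∘L a₁) ∘L γf =
        (d₂ + γk ∘L a₂ - a₂ ∘L γg) ∘L a₁ + a₂ ∘L (d₁ + γg ∘L a₁ - a₁ ∘L γf) := by
    intros
    ext w
    simp
    abel
  exact key _ _ _ _ _ _ _

/-- The identity is parallel. -/
theorem homCov_id (cov : Connection E M) {f : B → M} {b : B} (hf : ContinuousAt f b)
    (v : TangentSpace IB b) :
    homCov IB cov cov f f (fun b => ContinuousLinearMap.id ℝ (TangentSpace 𝓘(ℝ, E) (f b))) b v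
      = 0 := by
  have e := vderiv_congr (IB := IB) (homCoord_id (E := E) hf)
  rw [vderiv_const] at e
  rw [homCov_eq, e]
  have key : ∀ γ : E →L[ℝ] E, 0 + γ ∘L ContinuousLinearMap.id ℝ E -
      ContinuousLinearMap.id ℝ E ∘L γ = 0 := by
    intros; ext w; simp
  exact key _

theorem HomDiffAt.add {f : B → M} {g : B → N}
    {h k : ∀ b, TangentSpace 𝓘(ℝ, E) (f b) →L[ℝ] TangentSpace 𝓘(ℝ, E') (g b)} {b : B}
    (hh : HomDiffAt IB f g h b) (hk : HomDiffAt IB f g k b) :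
    HomDiffAt IB f g (fun b => h b + k b) b where
  source := hh.source
  target := hh.target
  coord := (hh.coord.add hk.coord).congr_of_eventuallyEq
    (Filter.Eventually.of_forall fun b' => homCoord_add f g h k b b')

theorem homCov_fun_add (covM : Connection E M) (covN : Connection E' N) {f : B → M} {g : B → N}
    {h k : ∀ b, TangentSpace 𝓘(ℝ, E) (f b) →L[ℝ] TangentSpace 𝓘(ℝ, E') (g b)} {b : B}
    (hh : HomDiffAt IB f g h b) (hk : HomDiffAt IB f g k b) (v : TangentSpace IB b) :
    homCov IB covM covN f g (fun b => h b + k b) b v =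
      homCov IB covM covN f g h b v + homCov IB covM covN f g k b v := by
  have e : vderiv IB (homCoord f g (fun b => h b + k b) b) b v =
      vderiv IB (homCoord f g h b) b v + vderiv IB (homCoord f g k b) b v := by
    rw [vderiv_congr (Filter.Eventually.of_forall fun b' => homCoord_add f g h k b b')]
    exact vderiv_add hh.coord hk.coord v
  rw [homCov_eq, homCov_eq, homCov_eq, e]
  have key : ∀ (d₁ a₁ d₂ a₂ : E →L[ℝ] E') (γf : E →L[ℝ] E) (γg : E' →L[ℝ] E'),
      (d₁ + d₂) + γg ∘L (a₁ + a₂) - (a₁ + a₂) ∘L γf =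
        (d₁ + γg ∘L a₁ - a₁ ∘L γf) + (d₂ + γg ∘L a₂ - a₂ ∘L γf) := by
    intros
    ext w
    simp
    abel
  exact key _ _ _ _ _ _

theorem HomDiffAt.smul {f : B → M} {g : B → N} {a : B → ℝ}
    {h : ∀ b, TangentSpace 𝓘(ℝ, E) (f b) →L[ℝ] TangentSpace 𝓘(ℝ, E') (g b)} {b : B}
    (ha : MDifferentiableAt IB 𝓘(ℝ, ℝ) a b) (hh : HomDiffAt IB f g h b) :
    HomDiffAt IB f g (fun b => a b • h b) b where
  source := hh.source
  target := hh.target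
  coord := (mdifferentiableAt_bilin (ContinuousLinearMap.lsmul ℝ ℝ) ha
    hh.coord).congr_of_eventuallyEq
    (Filter.Eventually.of_forall fun b' => homCoord_smul f g a h b b')

theorem homCov_fun_smul (covM : Connection E M) (covN : Connection E' N) {f : B → M} {g : B → N}
    {a : B → ℝ} {h : ∀ b, TangentSpace 𝓘(ℝ, E) (f b) →L[ℝ] TangentSpace 𝓘(ℝ, E') (g b)} {b : B}
    (ha : MDifferentiableAt IB 𝓘(ℝ, ℝ) a b) (hh : HomDiffAt IB f g h b) (v : TangentSpace IB b) :
    homCov IB covM covN f g (fun b => a b • h b) b v =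
      vderiv IB a b v • h b + a b • homCov IB covM covN f g h b v := by
  have e : vderiv IB (homCoord f g (fun b => a b • h b) b) b v =
      vderiv IB a b v • homCoord f g h b b + a b • vderiv IB (homCoord f g h b) b v := by
    rw [vderiv_congr (Filter.Eventually.of_forall fun b' => homCoord_smul f g a h b b')]
    exact vderiv_bilin (ContinuousLinearMap.lsmul ℝ ℝ) ha hh.coord v
  rw [homCoord_self] at e
  rw [homCov_eq, homCov_eq, e]
  have key : ∀ (r s : ℝ) (d a : E →L[ℝ] E') (γf : E →L[ℝ] E) (γg : E' →L[ℝ] E'),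
      (r • a + s • d) + γg ∘L (s • a) - (s • a) ∘L γf =
        r • a + s • (d + γg ∘L a - a ∘L γf) := by
    intros
    ext w
    simp
    module
  exact key _ _ _ _ _ _

theorem HomDiffAt.pullback {f : B → M} {g : B → N}
    {h : ∀ b, TangentSpace 𝓘(ℝ, E) (f b) →L[ℝ] TangentSpace 𝓘(ℝ, E') (g b)} {c : C → B} {t : C}
    (hh : HomDiffAt IB f g h (c t)) (hc : MDifferentiableAt IC IB c t) :
    HomDiffAt IC (fun s => f (c s)) (fun s => g (c s)) (fun s => h (c s)) t where
  source := hh.source.comp t hc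
  target := hh.target.comp t hc
  coord := hh.coord.comp t hc

/-- Naturality of the induced connections with respect to pull-backs. -/
theorem homCov_pullback (covM : Connection E M) (covN : Connection E' N) {f : B → M} {g : B → N}
    {h : ∀ b, TangentSpace 𝓘(ℝ, E) (f b) →L[ℝ] TangentSpace 𝓘(ℝ, E') (g b)} {c : C → B} {t : C}
    (hh : HomDiffAt IB f g h (c t)) (hc : MDifferentiableAt IC IB c t) (v : TangentSpace IC t) :
    homCov IC covM covN (fun s => f (c s)) (fun s => g (c s)) (fun s => h (c s)) t v =
      homCov IB covM covN f g h (c t) (mfderiv IC IB c t v) := by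
  have e : vderiv IC (homCoord (fun s => f (c s)) (fun s => g (c s)) (fun s => h (c s)) t) t v =
      vderiv IB (homCoord f g h (c t)) (c t) (mfderiv IC IB c t v) :=
    mfderiv_comp_apply t hh.coord hc v
  have ef : mfderiv IC 𝓘(ℝ, E) (fun s => f (c s)) t v =
      mfderiv IB 𝓘(ℝ, E) f (c t) (mfderiv IC IB c t v) := mfderiv_comp_apply t hh.source hc v
  have eg : mfderiv IC 𝓘(ℝ, E') (fun s => g (c s)) t v =
      mfderiv IB 𝓘(ℝ, E') g (c t) (mfderiv IC IB c t v) := mfderiv_comp_apply t hh.target hc v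
  rw [homCov_eq, homCov_eq, e, ef, eg]

end Calculus

/-! ## Quaternionic algebra -/

section Algebra

variable {R : Type*} [Ring R] {I J K : R}

theorem IsQuaternionicTriple.mul_table (h : IsQuaternionicTriple I J K) :
    I * J = K ∧ J * K = I ∧ K * I = J ∧ J * I = -K ∧ K * J = -I ∧ I * K = -J := by
  obtain ⟨hI, hJ, hK, hIJK⟩ := h
  have hIJ : I * J = K := by
    have : I * J * K * K = -K := by rw [hIJK]; simp
    rw [mul_assoc, hK] at this
    simpa using this
  have hJK : J * K = I := by
    have : I * (I * J * K) = -I := by rw [hIJK]; simp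
    rw [mul_assoc, ← mul_assoc, hI] at this
    simpa using this
  have hJI : J * I = -K := by
    have h1 : J * I * J = I := by rw [mul_assoc, hIJ, hJK]
    have h2 : J * I * J * J = K := by rw [h1, hIJ]
    rw [mul_assoc, hJ] at h2
    rw [← h2]; simp
  have hIK : I * K = -J := by rw [← hIJ, ← mul_assoc, hI]; simp
  have hKI : K * I = J := by rw [← hIJ, mul_assoc, hJI, mul_neg, hIK]; simp
  have hKJ : K * J = -I := by rw [← hIJ, mul_assoc, hJ]; simp
  exact ⟨hIJ, hJK, hKI, hJI, hKJ, hIK⟩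

variable [Algebra ℝ R]

/-- Product of imaginary quaternions: minus the dot product, plus the cross product. -/
theorem IsQuaternionicTriple.mul_eq (h : IsQuaternionicTriple I J K) (a b c a' b' c' : ℝ) :
    (a • I + b • J + c • K) * (a' • I + b' • J + c' • K) =
      -(a * a' + b * b' + c * c') • (1 : R) + ((b * c' - c * b') • I + (c * a' - a * c') • J
        + (a * b' - b * a') • K) := by
  obtain ⟨hIJ, hJK, hKI, hJI, hKJ, hIK⟩ := h.mul_table
  obtain ⟨hI, hJ, hK, -⟩ := h
  simp only [mul_add, add_mul, smul_mul_assoc, mul_smul_comm, hI, hJ, hK, hIJ, hJK,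
    hJI, hIK, hKI, hKJ]
  module

/-- Each of `I`, `J`, `K` is half a commutator, so a trace form kills it and sees only the scalar
part of a product. The coefficients in a quaternionic frame are thereby recovered by traces. -/
theorem IsQuaternionicTriple.trace_mul (h : IsQuaternionicTriple I J K) (T : R →ₗ[ℝ] ℝ)
    (hT : ∀ p q, T (p * q) = T (q * p)) (a b c : ℝ) :
    T ((a • I + b • J + c • K) * I) = -a * T 1 ∧ T ((a • I + b • J + c • K) * J) = -b * T 1 ∧
      T ((a • I + b • J + c • K) * K) = -c * T 1 := by
  obtain ⟨hIJ, hJK, hKI, hJI, hKJ, hIK⟩ := h.mul_table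
  have tI : T I = 0 := by
    have := hT J K
    rw [hJK, hKJ, map_neg] at this
    linarith
  have tJ : T J = 0 := by
    have := hT K I
    rw [hKI, hIK, map_neg] at this
    linarith
  have tK : T K = 0 := by
    have := hT I J
    rw [hIJ, hJI, map_neg] at this
    linarith
  have h1 := h.mul_eq a b c 1 0 0
  have h2 := h.mul_eq a b c 0 1 0
  have h3 := h.mul_eq a b c 0 0 1
  simp only [one_smul, zero_smul, add_zero, zero_add] at h1 h2 h3
  rw [h1, h2, h3]
  simp [tI, tJ, tK]

end Algebra

/-! ### Quaternionic algebra in the fibres of `Q_M`. -/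

section FibreAlgebra

variable {E : Type*} [NormedAddCommGroup E] [NormedSpace ℝ E] [FiniteDimensional ℝ E]
  {M : Type*} [TopologicalSpace M] [ChartedSpace E M] [IsManifold 𝓘(ℝ, E) ∞ M]

/-- The product of two elements of `(Q_M)_x` belongs to `ℝ ⊕ (Q_M)_x`. -/
theorem AlmostQuaternionicStructure.exists_mul_eq (A : AlmostQuaternionicStructure E M) {x : M}
    {q r : EndT E x} (hq : q ∈ A.Q x) (hr : r ∈ A.Q x) :
    ∃ (s : ℝ) (t : EndT E x), t ∈ A.Q x ∧ q * r = s • 1 + t := by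
  obtain ⟨U, I, J, K, -, hxU, -, hU⟩ := A.exists_frame x
  obtain ⟨hT, hQ⟩ := hU x hxU
  rw [hQ, Submodule.mem_span_triple] at hq hr
  obtain ⟨a, b, c, rfl⟩ := hq
  obtain ⟨a', b', c', rfl⟩ := hr
  refine ⟨_, _, ?_, hT.mul_eq a b c a' b' c'⟩
  rw [hQ, Submodule.mem_span_triple]
  exact ⟨_, _, _, rfl⟩

theorem AlmostQuaternionicStructure.exists_mul_self_eq (A : AlmostQuaternionicStructure E M) {x : M}
    {q : EndT E x} (hq : q ∈ A.Q x) : ∃ s : ℝ, 0 ≤ s ∧ q * q = -(s • (1 : EndT E x)) := by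
  obtain ⟨U, I, J, K, -, hxU, -, hU⟩ := A.exists_frame x
  obtain ⟨hT, hQ⟩ := hU x hxU
  rw [hQ, Submodule.mem_span_triple] at hq
  obtain ⟨a, b, c, rfl⟩ := hq
  exact ⟨_, by positivity, hT.mul_self a b c⟩

/-- A nonzero element of `ℝ ⊕ (Q_M)_x` is injective. -/
theorem AlmostQuaternionicStructure.smul_one_add_eq_zero (A : AlmostQuaternionicStructure E M)
    {x : M} {q : EndT E x} (hq : q ∈ A.Q x) (s : ℝ) {u : TangentSpace 𝓘(ℝ, E) x} (hu : u ≠ 0)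
    (h : s • u + q u = 0) : s • (1 : EndT E x) + q = 0 := by
  obtain ⟨r, hr, hqq⟩ := A.exists_mul_self_eq hq
  have h1 : q (q u) = -(r • u) := congrArg (fun f : EndT E x => f u) hqq
  have h2 : q u = -(s • u) := by rw [← add_eq_zero_iff_eq_neg, add_comm, h]
  -- From `q u = -s u` one gets `q² u = s² u`, whereas `q² = -r` with `r ≥ 0`; so `s² + r = 0` and
  -- `s = 0`.
  rw [h2, map_neg, map_smul, h2, smul_neg, neg_neg, smul_smul, ← add_eq_zero_iff_eq_neg,
    ← add_smul] at h1
  have h3 : s * s + r = 0 := (smul_eq_zero.1 h1).resolve_right hu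
  have h4 : s = 0 := by nlinarith [mul_self_nonneg s]
  rw [h4, zero_smul, neg_zero] at h2
  rw [h4, A.eq_zero_of_apply_eq_zero hq hu h2, zero_smul, add_zero]

/-- An identity `p = q r` between elements of `(Q_M)_x` can be checked on a nonzero vector. -/
theorem AlmostQuaternionicStructure.eq_mul_of_apply_eq (A : AlmostQuaternionicStructure E M)
    {x : M} {p q r : EndT E x} (hp : p ∈ A.Q x) (hq : q ∈ A.Q x) (hr : r ∈ A.Q x)
    {u : TangentSpace 𝓘(ℝ, E) x} (hu : u ≠ 0) (h : p u = q (r u)) : p = q * r := by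
  obtain ⟨s, t, ht, hst⟩ := A.exists_mul_eq hq hr
  have h1 : q (r u) = s • u + t u := congrArg (fun f : EndT E x => f u) hst
  -- The difference `q r - p` lies in `ℝ ⊕ Q_M` and kills `u ≠ 0`.
  have h2 : s • u + (t - p) u = 0 := by
    rw [sub_apply, h, h1]
    abel
  have h3 := A.smul_one_add_eq_zero (Submodule.sub_mem _ ht hp) s hu h2
  rw [hst, ← sub_eq_zero, ← neg_eq_zero, ← h3]
  abel

end FibreAlgebra

/-! ## Smooth sections of the bundle of endomorphisms -/

section Smoothness

variable {E : Type*} [NormedAddCommGroup E] [NormedSpace ℝ E] [FiniteDimensional ℝ E]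
  {M : Type*} [TopologicalSpace M] [ChartedSpace E M] [IsManifold 𝓘(ℝ, E) ∞ M]
  {E' : Type*} [NormedAddCommGroup E'] [NormedSpace ℝ E'] [FiniteDimensional ℝ E']
  {N : Type*} [TopologicalSpace N] [ChartedSpace E' N] [IsManifold 𝓘(ℝ, E') ∞ N]
  {EB : Type*} [NormedAddCommGroup EB] [NormedSpace ℝ EB] {HB : Type*} [TopologicalSpace HB]
  {IB : ModelWithCorners ℝ EB HB} {B : Type*} [TopologicalSpace B] [ChartedSpace HB B]

theorem contMDiffAt_endTotal_iff {f : B → M} {h : ∀ b, EndT E (f b)} {b : B} :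
    ContMDiffAt IB (endModel E) ∞ (fun b => (⟨f b, h b⟩ : EndTotal E M)) b ↔
      ContMDiffAt IB 𝓘(ℝ, E) ∞ f b ∧ ContMDiffAt IB 𝓘(ℝ, E →L[ℝ] E) ∞ (homCoord f f h b) b :=
  contMDiffAt_hom_bundle _

theorem homDiffAt_of_contMDiffAt {f : B → M} {h : ∀ b, EndT E (f b)} {b : B}
    (hc : ContMDiffAt IB (endModel E) ∞ (fun b => (⟨f b, h b⟩ : EndTotal E M)) b) :
    HomDiffAt IB f f h b :=
  ⟨(contMDiffAt_endTotal_iff.1 hc).1.mdifferentiableAt (by simp),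
    (contMDiffAt_endTotal_iff.1 hc).1.mdifferentiableAt (by simp),
    (contMDiffAt_endTotal_iff.1 hc).2.mdifferentiableAt (by simp)⟩

theorem SmoothEndAt.homDiffAt {S : ∀ y : M, EndT E y} {x : M} (hS : SmoothEndAt S x) :
    HomDiffAt 𝓘(ℝ, E) id id S x :=
  homDiffAt_of_contMDiffAt hS

theorem homDiffAt_mfderiv {φ : M → N} (hφ : ContMDiff 𝓘(ℝ, E) 𝓘(ℝ, E') ∞ φ) (x : M) :
    HomDiffAt 𝓘(ℝ, E) id φ (fun y => mfderiv 𝓘(ℝ, E) 𝓘(ℝ, E') φ y) x where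
  source := mdifferentiableAt_id
  target := (hφ x).mdifferentiableAt (by simp)
  -- Regularity `m = 1` of the differential costs `1 + 1 ≤ ∞` derivatives of `φ` and suffices for
  -- differentiability.
  coord := ((hφ x).mfderiv_const (m := 1)
    (WithTop.coe_le_coe.2 (le_top : (1 + 1 : ℕ∞) ≤ ⊤))).mdifferentiableAt (by simp)

/-- The tautological section of the pull-back of `End(TM)` to its total space is differentiable. -/
theorem homDiffAt_tautological (p : EndTotal E M) :
    HomDiffAt (endModel E) (fun q : EndTotal E M => q.proj) (fun q : EndTotal E M => q.proj)
      (fun q => q.2) p :=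
  homDiffAt_of_contMDiffAt (f := fun q : EndTotal E M => q.proj) (h := fun q => q.2)
    (contMDiffAt_id (I := endModel E))

/-- The section `h` is the pull-back of the tautological section by the map `b ↦ (f b, h b)`, so
this is naturality. It turns vertical components of velocities into covariant derivatives along
curves. -/
theorem verticalPart_mfderiv (cov : Connection E M) {f : B → M} {h : ∀ b, EndT E (f b)} {b : B}
    (hc : ContMDiffAt IB (endModel E) ∞ (fun b => (⟨f b, h b⟩ : EndTotal E M)) b)
    (v : TangentSpace IB b) :
    verticalPart cov ⟨f b, h b⟩
        (mfderiv IB (endModel E) (fun b => (⟨f b, h b⟩ : EndTotal E M)) b v) =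
      homCov IB cov cov f f h b v :=
  (homCov_pullback cov cov (c := fun b => (⟨f b, h b⟩ : EndTotal E M))
    (homDiffAt_tautological (⟨f b, h b⟩ : EndTotal E M)) (hc.mdifferentiableAt (by simp)) v).symm

theorem horizontalPart_mfderiv {f : B → M} {h : ∀ b, EndT E (f b)} {b : B}
    (hc : ContMDiffAt IB (endModel E) ∞ (fun b => (⟨f b, h b⟩ : EndTotal E M)) b)
    (v : TangentSpace IB b) :
    horizontalPart ⟨f b, h b⟩
        (mfderiv IB (endModel E) (fun b => (⟨f b, h b⟩ : EndTotal E M)) b v) =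
      mfderiv IB 𝓘(ℝ, E) f b v :=
  (mfderiv_comp_apply (f := fun b => (⟨f b, h b⟩ : EndTotal E M)) b
    (homDiffAt_tautological (⟨f b, h b⟩ : EndTotal E M)).source
    (hc.mdifferentiableAt (by simp)) v).symm

theorem homDiffAt_frame {f : B → M} {b : B} (hf : MDifferentiableAt IB 𝓘(ℝ, E) f b)
    {S : ∀ y : M, EndT E y} (hS : SmoothEndAt S (f b)) {a : B → ℝ}
    (ha : MDifferentiableAt IB 𝓘(ℝ, ℝ) a b) :
    HomDiffAt IB f f (fun b => a b • S (f b)) b :=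
  HomDiffAt.smul ha (hS.homDiffAt.pullback hf)

theorem homCov_frame (cov : Connection E M) {f : B → M} {b : B}
    (hf : MDifferentiableAt IB 𝓘(ℝ, E) f b)
    {S : ∀ y : M, EndT E y} (hS : SmoothEndAt S (f b)) {a : B → ℝ}
    (ha : MDifferentiableAt IB 𝓘(ℝ, ℝ) a b) (v : TangentSpace IB b) :
    homCov IB cov cov f f (fun b => a b • S (f b)) b v =
      vderiv IB a b v • S (f b) + a b • endCov cov S (f b) (mfderiv IB 𝓘(ℝ, E) f b v) := by
  have hp : HomDiffAt IB f f (fun b => S (f b)) b := hS.homDiffAt.pullback hf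
  have e : homCov IB cov cov f f (fun b => S (f b)) b v =
      endCov cov S (f b) (mfderiv IB 𝓘(ℝ, E) f b v) :=
    homCov_pullback cov cov hS.homDiffAt hf v
  rw [homCov_fun_smul cov cov ha hp, e]

theorem homCov_frame₃ (cov : Connection E M) {f : B → M} {b : B}
    (hf : MDifferentiableAt IB 𝓘(ℝ, E) f b)
    {I J K : ∀ y : M, EndT E y} (hI : SmoothEndAt I (f b)) (hJ : SmoothEndAt J (f b))
    (hK : SmoothEndAt K (f b)) {a₁ a₂ a₃ : B → ℝ}
    (ha₁ : MDifferentiableAt IB 𝓘(ℝ, ℝ) a₁ b) (ha₂ : MDifferentiableAt IB 𝓘(ℝ, ℝ) a₂ b)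
    (ha₃ : MDifferentiableAt IB 𝓘(ℝ, ℝ) a₃ b) (v : TangentSpace IB b) :
    homCov IB cov cov f f (fun b => a₁ b • I (f b) + a₂ b • J (f b) + a₃ b • K (f b)) b v =
      (vderiv IB a₁ b v • I (f b) + vderiv IB a₂ b v • J (f b) + vderiv IB a₃ b v • K (f b)) +
      (a₁ b • endCov cov I (f b) (mfderiv IB 𝓘(ℝ, E) f b v) +
        a₂ b • endCov cov J (f b) (mfderiv IB 𝓘(ℝ, E) f b v) +
        a₃ b • endCov cov K (f b) (mfderiv IB 𝓘(ℝ, E) f b v)) := by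
  have h₁ := homDiffAt_frame hf hI ha₁
  have h₂ := homDiffAt_frame hf hJ ha₂
  have h₃ := homDiffAt_frame hf hK ha₃
  rw [homCov_fun_add cov cov (h₁.add h₂) h₃, homCov_fun_add cov cov h₁ h₂,
    homCov_frame cov hf hI ha₁, homCov_frame cov hf hJ ha₂, homCov_frame cov hf hK ha₃]
  abel

end Smoothness

/-! ## Induced connections on the bundle `Q_M` -/

section InducedConnection

variable {E : Type*} [NormedAddCommGroup E] [NormedSpace ℝ E] [FiniteDimensional ℝ E]
  {M : Type*} [TopologicalSpace M] [ChartedSpace E M] [IsManifold 𝓘(ℝ, E) ∞ M]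
  {EB : Type*} [NormedAddCommGroup EB] [NormedSpace ℝ EB] {HB : Type*} [TopologicalSpace HB]
  {IB : ModelWithCorners ℝ EB HB} {B : Type*} [TopologicalSpace B] [ChartedSpace HB B]

/-- The matrix, in the preferred chart at `x`, of an endomorphism of `T_y M`. -/
def endCoord (x y : M) : EndT E y →ₗ[ℝ] (E →L[ℝ] E) where
  toFun r := (trivializationAt E (TangentSpace 𝓘(ℝ, E) : M → Type _) x).continuousLinearMapAt ℝ y
    ∘L r ∘L (trivializationAt E (TangentSpace 𝓘(ℝ, E) : M → Type _) x).symmL ℝ y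
  map_add' r r' := by ext w; simp
  map_smul' c r := by ext w; simp

theorem endCoord_mul {x y : M}
    (hy : y ∈ (trivializationAt E (TangentSpace 𝓘(ℝ, E) : M → Type _) x).baseSet)
    (r s : EndT E y) : endCoord x y (r * s) = endCoord x y r * endCoord x y s := by
  refine ContinuousLinearMap.ext fun w => ?_
  refine congrArg (fun z => (trivializationAt E (TangentSpace 𝓘(ℝ, E) : M → Type _)
    x).continuousLinearMapAt ℝ y (r z)) ?_
  exact (Trivialization.symmL_continuousLinearMapAt _ hy _).symm

theorem endCoord_one {x y : M}
    (hy : y ∈ (trivializationAt E (TangentSpace 𝓘(ℝ, E) : M → Type _) x).baseSet) :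
    endCoord x y (1 : EndT E y) = 1 :=
  ContinuousLinearMap.ext fun w => Trivialization.continuousLinearMapAt_symmL _ hy w

/-- The trace of a continuous endomorphism. -/
def clmTrace (E : Type*) [NormedAddCommGroup E] [NormedSpace ℝ E] [FiniteDimensional ℝ E] :
    (E →L[ℝ] E) →L[ℝ] ℝ :=
  LinearMap.toContinuousLinearMap (LinearMap.trace ℝ E ∘ₗ ContinuousLinearMap.coeLM ℝ)

theorem clmTrace_mul (p q : E →L[ℝ] E) : clmTrace E (p * q) = clmTrace E (q * p) :=
  LinearMap.trace_mul_comm ℝ (p : E →ₗ[ℝ] E) (q : E →ₗ[ℝ] E)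

theorem clmTrace_one : clmTrace E 1 = Module.finrank ℝ E :=
  LinearMap.trace_one ℝ E

/-- A connection inducing a connection on `Q_M` also induces one on the pull-backs of `Q_M`. -/
theorem homCov_mem {A : AlmostQuaternionicStructure E M} {cov : Connection E M}
    (hcov : IsAlmostQuaternionicConnection A cov) {f : B → M} {q : ∀ b, EndT E (f b)} {b : B}
    (hq : HomDiffAt IB f f q b) (hm : ∀ᶠ b' in 𝓝 b, q b' ∈ A.Q (f b')) (v : TangentSpace IB b) :
    homCov IB cov cov f f q b v ∈ A.Q (f b) := by
  -- The trace coefficients below are divided by `dim E`, so dimension zero is treated apart.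
  rcases subsingleton_or_nontrivial E with hE | hE
  · have : homCov IB cov cov f f q b v = 0 :=
      ContinuousLinearMap.ext fun w => Subsingleton.elim (α := E) _ _
    rw [this]
    exact Submodule.zero_mem _
  obtain ⟨U, I, J, K, hUo, hxU, hsm, hU⟩ := A.exists_frame (f b)
  obtain ⟨hI, hJ, hK⟩ := hsm _ hxU
  have hn : (Module.finrank ℝ E : ℝ) ≠ 0 := by
    have := Module.finrank_pos (R := ℝ) (M := E)
    positivity
  -- The hypothesis on `cov` concerns sections over `M` only, so `q` is expanded in the pulled-back
  -- frame. The coefficient along `S` is `-tr(q S) / dim E`, an expression visibly differentiable in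
  -- `b'`.
  let a : (∀ y : M, EndT E y) → B → ℝ := fun S b' => (-(Module.finrank ℝ E : ℝ)⁻¹) •
    clmTrace E (homCoord f f q b b' ∘L homCoord f f (fun b => S (f b)) b b')
  have ha : ∀ S : ∀ y : M, EndT E y, SmoothEndAt S (f b) →
      MDifferentiableAt IB 𝓘(ℝ, ℝ) (a S) b := by
    intro S hS
    have hp : HomDiffAt IB f f (fun b => S (f b)) b := hS.homDiffAt.pullback hq.source
    have h1 := mdifferentiableAt_bilin (ContinuousLinearMap.compL ℝ E E E) hq.coord hp.coord
    exact (((-(Module.finrank ℝ E : ℝ)⁻¹) • clmTrace E).differentiableAt.mdifferentiableAt).comp b h1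
  have e : ∀ᶠ b' in 𝓝 b, q b' =
      a I b' • I (f b') + a J b' • J (f b') + a K b' • K (f b') := by
    have hx := FiberBundle.mem_baseSet_trivializationAt E (TangentSpace 𝓘(ℝ, E) : M → Type _) (f b)
    filter_upwards [hm, hq.source.continuousAt (hUo.mem_nhds hxU), hq.source.continuousAt
      ((trivializationAt E (TangentSpace 𝓘(ℝ, E) : M → Type _) (f b)).open_baseSet.mem_nhds hx)]
      with b' h1 h2 h3
    obtain ⟨hT, hQ⟩ := hU _ h2
    rw [hQ, Submodule.mem_span_triple] at h1
    obtain ⟨α, β, γ, h1⟩ := h1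
    let T : EndT E (f b') →ₗ[ℝ] ℝ := (clmTrace E).toLinearMap ∘ₗ endCoord (f b) (f b')
    have hTm : ∀ r s, T (r * s) =
        clmTrace E (endCoord (f b) (f b') r * endCoord (f b) (f b') s) := fun r s =>
      congrArg (clmTrace E) (endCoord_mul h3 r s)
    have hT1 : T 1 = Module.finrank ℝ E :=
      (congrArg (clmTrace E) (endCoord_one h3)).trans clmTrace_one
    obtain ⟨t1, t2, t3⟩ := hT.trace_mul T
      (fun r s => by rw [hTm, hTm, clmTrace_mul]) α β γ
    rw [h1, hT1] at t1 t2 t3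
    have hc : ∀ S : ∀ y : M, EndT E y, a S b' =
        (-(Module.finrank ℝ E : ℝ)⁻¹) * T (q b' * S (f b')) := fun S => by
      rw [hTm]; rfl
    have d1 : a I b' = α := by rw [hc, t1]; field_simp
    have d2 : a J b' = β := by rw [hc, t2]; field_simp
    have d3 : a K b' = γ := by rw [hc, t3]; field_simp
    rw [d1, d2, d3, h1]
  -- By the Leibniz rule only frame elements and their derivatives over `M` remain; the former lie
  -- in `Q_M` and the latter do by `hcov`.
  rw [homCov_congr cov cov e, homCov_frame₃ cov hq.source hI hJ hK (ha I hI) (ha J hJ) (ha K hK)]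
  have hmem : ∀ S : ∀ y : M, EndT E y, SmoothEndAt S (f b) → (∀ y ∈ U, S y ∈ A.Q y) →
      ∀ (c d : ℝ) w, c • S (f b) ∈ A.Q (f b) ∧ d • endCov cov S (f b) w ∈ A.Q (f b) :=
    fun S hS hSU c d w => ⟨Submodule.smul_mem _ _ (hSU _ hxU), Submodule.smul_mem _ _
      (hcov _ _ hS (Filter.eventually_of_mem (hUo.mem_nhds hxU) hSU) w)⟩
  have hIU := hmem I hI fun y hy => by rw [(hU y hy).2]; exact Submodule.subset_span (by simp)
  have hJU := hmem J hJ fun y hy => by rw [(hU y hy).2]; exact Submodule.subset_span (by simp)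
  have hKU := hmem K hK fun y hy => by rw [(hU y hy).2]; exact Submodule.subset_span (by simp)
  exact Submodule.add_mem _
    (Submodule.add_mem _ (Submodule.add_mem _ (hIU _ 0 0).1 (hJU _ 0 0).1) (hKU _ 0 0).1)
    (Submodule.add_mem _ (Submodule.add_mem _ (hIU 0 _ _).2 (hJU 0 _ _).2) (hKU 0 _ _).2)

/-- The covariant derivative of a field of complex structures anticommutes with it. -/
theorem homCov_anticommute (cov : Connection E M) {f : B → M} {q : ∀ b, EndT E (f b)} {b : B}
    (hq : HomDiffAt IB f f q b) (hm : ∀ᶠ b' in 𝓝 b, q b' * q b' = -1) (v : TangentSpace IB b) :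
    (homCov IB cov cov f f q b v : EndT E (f b)) * q b + q b * homCov IB cov cov f f q b v = 0 := by
  have hid : HomDiffAt IB f f
      (fun b => ContinuousLinearMap.id ℝ (TangentSpace 𝓘(ℝ, E) (f b))) b :=
    ⟨hq.source, hq.source,
      mdifferentiableAt_const.congr_of_eventuallyEq (homCoord_id hq.source.continuousAt)⟩
  -- Differentiate `q ∘ q = -id`; the right side is a constant multiple of the parallel identity.
  have h1 := homCov_comp cov cov cov hq hq v
  have e : ∀ᶠ b' in 𝓝 b, q b' ∘L q b' =
      (fun _ => (-1 : ℝ)) b' • ContinuousLinearMap.id ℝ (TangentSpace 𝓘(ℝ, E) (f b')) :=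
    hm.mono fun b' hb' => hb'.trans (by rw [neg_smul, one_smul]; rfl)
  rw [homCov_congr cov cov e, homCov_fun_smul cov cov mdifferentiableAt_const hid,
    homCov_id cov hq.source.continuousAt, vderiv_const, smul_zero, add_zero] at h1
  rw [ContinuousLinearMap.mul_def, ContinuousLinearMap.mul_def, ← h1]
  exact zero_smul ℝ _

end InducedConnection

/-! ## Sections of the twistor space and horizontal curves -/

section Lifts

variable {E : Type*} [NormedAddCommGroup E] [NormedSpace ℝ E] [FiniteDimensional ℝ E]
  {M : Type*} [TopologicalSpace M] [ChartedSpace E M] [IsManifold 𝓘(ℝ, E) ∞ M]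
  {EB : Type*} [NormedAddCommGroup EB] [NormedSpace ℝ EB] {HB : Type*} [TopologicalSpace HB]
  {IB : ModelWithCorners ℝ EB HB} {B : Type*} [TopologicalSpace B] [ChartedSpace HB B]

/-- The unit tangent vector to `ℝ` at `0`. -/
def unitTangent : TangentSpace 𝓘(ℝ, ℝ) (0 : ℝ) := (1 : ℝ)

/-- A smooth curve with prescribed velocity. -/
theorem exists_curve (x : M) (X : TangentSpace 𝓘(ℝ, E) x) :
    ∃ γ : ℝ → M, ContMDiffAt 𝓘(ℝ, ℝ) 𝓘(ℝ, E) ∞ γ 0 ∧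
      (⟨γ 0, mfderiv 𝓘(ℝ, ℝ) 𝓘(ℝ, E) γ 0 unitTangent⟩ : TangentBundle 𝓘(ℝ, E) M) = ⟨x, X⟩ := by
  let X' : E := X
  let l : ℝ → E := fun t => extChartAt 𝓘(ℝ, E) x x + t • X'
  let γ : ℝ → M := fun t => (extChartAt 𝓘(ℝ, E) x).symm (l t)
  have hl : ContDiff ℝ ∞ l := by fun_prop
  have hl0 : l 0 = extChartAt 𝓘(ℝ, E) x x := by simp [l]
  have h0 : γ 0 = x := by simp only [γ, hl0]; exact extChartAt_to_inv x
  have hγ : ContMDiffAt 𝓘(ℝ, ℝ) 𝓘(ℝ, E) ∞ γ 0 := by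
    have h1 : ContMDiffAt 𝓘(ℝ, E) 𝓘(ℝ, E) ∞ (extChartAt 𝓘(ℝ, E) x).symm (l 0) := by
      rw [hl0]
      exact (contMDiffOn_extChartAt_symm x).contMDiffAt (extChartAt_target_mem_nhds x)
    exact h1.comp 0 hl.contMDiff.contMDiffAt
  refine ⟨γ, hγ, ?_⟩
  have hd : HasDerivAt l X' 0 := by
    have := ((hasDerivAt_id (0 : ℝ)).smul_const X').const_add (extChartAt 𝓘(ℝ, E) x x)
    rwa [one_smul] at this
  -- Since `γ 0 = x`, the chart used by `mfderiv` is the one at `x`, in which `γ` is the straight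
  -- line `l` near `0`.
  have key : (mfderiv 𝓘(ℝ, ℝ) 𝓘(ℝ, E) γ 0 unitTangent : E) = X' := by
    rw [(hγ.mdifferentiableAt (by simp)).mfderiv]
    have e : writtenInExtChartAt 𝓘(ℝ, ℝ) 𝓘(ℝ, E) (0 : ℝ) γ =ᶠ[𝓝 (0 : ℝ)] l := by
      have : l ⁻¹' (extChartAt 𝓘(ℝ, E) x).target ∈ 𝓝 (0 : ℝ) :=
        hl.continuous.continuousAt (by rw [hl0]; exact extChartAt_target_mem_nhds x)
      filter_upwards [this] with t ht
      simp only [writtenInExtChartAt, h0, Function.comp_apply]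
      exact (extChartAt 𝓘(ℝ, E) x).right_inv ht
    have h2 : fderivWithin ℝ (writtenInExtChartAt 𝓘(ℝ, ℝ) 𝓘(ℝ, E) (0 : ℝ) γ) (Set.range 𝓘(ℝ, ℝ))
        (extChartAt 𝓘(ℝ, ℝ) (0 : ℝ) 0) = fderiv ℝ l 0 := by
      rw [modelWithCornersSelf_coe, Set.range_id, fderivWithin_univ]
      exact e.fderiv_eq (𝕜 := ℝ)
    refine (congrArg (fun L : ℝ →L[ℝ] E => L 1) h2).trans ?_
    rw [hd.hasFDerivAt.fderiv]
    simp
  exact TotalSpace.ext h0 (heq_of_eq key)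

theorem AlmostQuaternionicStructure.nonempty_Z (A : AlmostQuaternionicStructure E M) (x : M) :
    Nonempty (A.Z x) := by
  obtain ⟨U, I, J, K, -, hxU, -, hU⟩ := A.exists_frame x
  obtain ⟨hT, hQ⟩ := hU x hxU
  exact ⟨⟨I x, by rw [hQ]; exact Submodule.subset_span (by simp), hT.1⟩⟩

/-- Linear combinations of a quaternionic frame, with coefficients on the unit sphere. -/
theorem AlmostQuaternionicStructure.exists_lift (A : AlmostQuaternionicStructure E M) {f : B → M}
    {b : B} (hf : ContMDiffAt IB 𝓘(ℝ, E) ∞ f b) {U : Set M} (hUo : IsOpen U) (hbU : f b ∈ U)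
    {I J K : ∀ y : M, EndT E y} (hI : SmoothEndAt I (f b)) (hJ : SmoothEndAt J (f b))
    (hK : SmoothEndAt K (f b))
    (hU : ∀ y ∈ U, IsQuaternionicTriple (I y) (J y) (K y) ∧ A.Q y = Submodule.span ℝ {I y, J y, K y})
    {a₁ a₂ a₃ : B → ℝ} (ha₁ : ContMDiffAt IB 𝓘(ℝ, ℝ) ∞ a₁ b) (ha₂ : ContMDiffAt IB 𝓘(ℝ, ℝ) ∞ a₂ b)
    (ha₃ : ContMDiffAt IB 𝓘(ℝ, ℝ) ∞ a₃ b) (ha : ∀ b, a₁ b ^ 2 + a₂ b ^ 2 + a₃ b ^ 2 = 1) :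
    ∃ s : ∀ b, A.Z (f b),
      (∀ b, f b ∈ U → (s b).1 = a₁ b • I (f b) + a₂ b • J (f b) + a₃ b • K (f b)) ∧
      ContMDiffAt IB (endModel E) ∞ (fun b => (⟨f b, (s b).1⟩ : EndTotal E M)) b := by
  classical
  have hZ : ∀ b, f b ∈ U → a₁ b • I (f b) + a₂ b • J (f b) + a₃ b • K (f b) ∈ A.Q (f b) ∧
      (a₁ b • I (f b) + a₂ b • J (f b) + a₃ b • K (f b)) *
        (a₁ b • I (f b) + a₂ b • J (f b) + a₃ b • K (f b)) = -1 := by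
    intro b hb
    obtain ⟨hT, hQ⟩ := hU _ hb
    refine ⟨?_, by rw [hT.mul_self, ha, one_smul]⟩
    rw [hQ, Submodule.mem_span_triple]
    exact ⟨_, _, _, rfl⟩
  -- Off the domain of the frame an arbitrary point of the fibre is taken; the germ at `b` does not
  -- see it.
  let s : ∀ b, A.Z (f b) := fun b =>
    if h : f b ∈ U then ⟨_, hZ b h⟩ else (A.nonempty_Z (f b)).some
  have hs : ∀ b, f b ∈ U → (s b).1 = a₁ b • I (f b) + a₂ b • J (f b) + a₃ b • K (f b) := by
    intro b hb
    simp only [s, dif_pos hb]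
  refine ⟨s, hs, contMDiffAt_endTotal_iff.2 ⟨hf, ?_⟩⟩
  have hc : ∀ S : ∀ y : M, EndT E y, SmoothEndAt S (f b) →
      ContMDiffAt IB 𝓘(ℝ, E →L[ℝ] E) ∞ (homCoord f f (fun b => S (f b)) b) b := fun S hS =>
    (contMDiffAt_endTotal_iff.1 (ContMDiffAt.comp (I' := 𝓘(ℝ, E))
      (g := fun y => (⟨y, S y⟩ : EndTotal E M)) b hS hf)).2
  refine (((ha₁.smul (hc I hI)).add (ha₂.smul (hc J hJ))).add
    (ha₃.smul (hc K hK))).congr_of_eventuallyEq ?_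
  filter_upwards [hf.continuousAt (hUo.mem_nhds hbU)] with b' hb'
  have e : homCoord f f (fun b => (s b).1) b b' = homCoord f f (fun b =>
      a₁ b • I (f b) + a₂ b • J (f b) + a₃ b • K (f b)) b b' := by
    simp only [homCoord_eq, hs b' hb']
  rw [e, homCoord_add, homCoord_add, homCoord_smul, homCoord_smul, homCoord_smul]
  rfl

/-- By `mul_self` the square of `q` is minus the squared length of its coefficients. In dimension
zero all endomorphisms coincide, so any unit vector of coefficients works. -/
theorem IsQuaternionicTriple.exists_coeff {x : M} {I J K : EndT E x}
    (hT : IsQuaternionicTriple I J K) {q : EndT E x} (hq : q ∈ Submodule.span ℝ {I, J, K})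
    (hqq : q * q = -1) : ∃ a b c : ℝ, a ^ 2 + b ^ 2 + c ^ 2 = 1 ∧ q = a • I + b • J + c • K := by
  rcases subsingleton_or_nontrivial E with hE | hE
  · exact ⟨1, 0, 0, by norm_num, ContinuousLinearMap.ext fun w => Subsingleton.elim (α := E) _ _⟩
  rw [Submodule.mem_span_triple] at hq
  obtain ⟨a, b, c, rfl⟩ := hq
  refine ⟨a, b, c, ?_, rfl⟩
  rw [hT.mul_self, neg_inj] at hqq
  obtain ⟨w, hw⟩ := exists_ne (0 : E)
  have h1 : (a ^ 2 + b ^ 2 + c ^ 2) • w = w := congrArg (fun f : E →L[ℝ] E => f w) hqq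
  have h2 : (a ^ 2 + b ^ 2 + c ^ 2 - 1) • w = 0 := by rw [sub_smul, h1, one_smul, sub_self]
  linarith [(smul_eq_zero.1 h2).resolve_right hw]

/-- The anticommutator of two imaginary quaternions is `-2` times their dot product, so
anticommuting means being tangent to the sphere. -/
theorem IsQuaternionicTriple.exists_orthogonal_coeff {x : M} {I J K : EndT E x}
    (hT : IsQuaternionicTriple I J K) {a b c : ℝ} {q : EndT E x}
    (hq : q ∈ Submodule.span ℝ {I, J, K})
    (h : q * (a • I + b • J + c • K) + (a • I + b • J + c • K) * q = 0) :
    ∃ u v w : ℝ, a * u + b * v + c * w = 0 ∧ q = u • I + v • J + w • K := by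
  rcases subsingleton_or_nontrivial E with hE | hE
  · exact ⟨0, 0, 0, by norm_num, ContinuousLinearMap.ext fun w => Subsingleton.elim (α := E) _ _⟩
  rw [Submodule.mem_span_triple] at hq
  obtain ⟨u, v, w, rfl⟩ := hq
  refine ⟨u, v, w, ?_, rfl⟩
  rw [hT.mul_eq, hT.mul_eq] at h
  have h0 : (a * u + b * v + c * w) • (1 : EndT E x) = 0 := by
    have h2 : (-2 : ℝ) • ((a * u + b * v + c * w) • (1 : EndT E x)) = 0 := by
      rw [← h]; module
    exact (smul_eq_zero.1 h2).resolve_left (by norm_num)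
  obtain ⟨z, hz⟩ := exists_ne (0 : E)
  have h1 : (a * u + b * v + c * w) • z = 0 := congrArg (fun f : E →L[ℝ] E => f z) h0
  exact (smul_eq_zero.1 h1).resolve_right hz

/-- Every element of `Z_M` extends to a section of `Z_M`, smooth nearby. -/
theorem AlmostQuaternionicStructure.exists_section (A : AlmostQuaternionicStructure E M) {x : M}
    (j : A.Z x) : ∃ S : ∀ y : M, A.Z y, S x = j ∧ SmoothEndAt (fun y => (S y).1) x := by
  obtain ⟨U, I, J, K, hUo, hxU, hsm, hU⟩ := A.exists_frame x
  obtain ⟨hI, hJ, hK⟩ := hsm _ hxU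
  obtain ⟨a, b, c, habc, hj⟩ := (hU x hxU).1.exists_coeff
    (by rw [← (hU x hxU).2]; exact j.2.1) j.2.2
  obtain ⟨S, hS, hSs⟩ := A.exists_lift (IB := 𝓘(ℝ, E)) (f := fun y : M => y) (b := x) contMDiffAt_id
    hUo hxU hI hJ hK hU (a₁ := fun _ => a) (a₂ := fun _ => b) (a₃ := fun _ => c)
    contMDiffAt_const contMDiffAt_const contMDiffAt_const (fun _ => habc)
  exact ⟨S, Subtype.ext ((hS x hxU).trans hj.symm), hSs⟩

/-- A curve on the unit sphere through `a`, with derivative `-w` at `0` (in one coordinate). -/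
def sphereCurve (m a w t : ℝ) : ℝ := ((1 - t ^ 2 * m / 4) * a - t * w) / (1 + t ^ 2 * m / 4)

theorem sphereCurve_zero (m a w : ℝ) : sphereCurve m a w 0 = a := by simp [sphereCurve]

theorem contMDiff_sphereCurve {m : ℝ} (hm : 0 ≤ m) (a w : ℝ) :
    ContMDiff 𝓘(ℝ, ℝ) 𝓘(ℝ, ℝ) ∞ (sphereCurve m a w) := by
  refine ContDiff.contMDiff (ContDiff.div (by fun_prop) (by fun_prop) fun t => ?_)
  positivity

theorem vderiv_sphereCurve (m a w : ℝ) :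
    vderiv 𝓘(ℝ, ℝ) (sphereCurve m a w) 0 unitTangent = -w := by
  have h1 : HasDerivAt (fun t : ℝ => t ^ 2 * m / 4) 0 0 := by
    have := (((hasDerivAt_id (0 : ℝ)).pow 2).mul_const m).div_const 4
    simpa using this
  have h2 : HasDerivAt (fun t : ℝ => (1 - t ^ 2 * m / 4) * a - t * w) (-w) 0 := by
    have := ((h1.const_sub 1).mul_const a).sub ((hasDerivAt_id (0 : ℝ)).mul_const w)
    exact this.congr_deriv (by simp)
  have h3 := h2.div (h1.const_add 1) (by norm_num)
  have h4 : HasDerivAt (sphereCurve m a w) (-w) 0 := by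
    refine h3.congr_deriv ?_
    simp
  have : mfderiv 𝓘(ℝ, ℝ) 𝓘(ℝ, ℝ) (sphereCurve m a w) 0 = fderiv ℝ (sphereCurve m a w) 0 :=
    mfderiv_eq_fderiv
  refine (congrArg (fun L : ℝ →L[ℝ] ℝ => L 1) this).trans ?_
  rw [h4.hasFDerivAt.fderiv]
  simp

theorem sphereCurve_sq {a b c u v w : ℝ} (h : a ^ 2 + b ^ 2 + c ^ 2 = 1)
    (h' : a * u + b * v + c * w = 0) (t : ℝ) :
    sphereCurve (u ^ 2 + v ^ 2 + w ^ 2) a u t ^ 2 + sphereCurve (u ^ 2 + v ^ 2 + w ^ 2) b v t ^ 2 +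
      sphereCurve (u ^ 2 + v ^ 2 + w ^ 2) c w t ^ 2 = 1 := by
  have hp : (1 + t ^ 2 * (u ^ 2 + v ^ 2 + w ^ 2) / 4) ≠ 0 := by positivity
  simp only [sphereCurve, div_pow, ← add_div]
  rw [div_eq_one_iff_eq (pow_ne_zero 2 hp)]
  -- With `s = t² m / 4` and `m = u² + v² + w²`, this is `(1 - s)² + 4s = (1 + s)²`, the cross terms
  -- vanishing by orthogonality.
  linear_combination (1 - t ^ 2 * (u ^ 2 + v ^ 2 + w ^ 2) / 4) ^ 2 * h -
    2 * t * (1 - t ^ 2 * (u ^ 2 + v ^ 2 + w ^ 2) / 4) * h'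

/-- Horizontal lifts to `Z_M`, to first order. -/
theorem AlmostQuaternionicStructure.exists_horizontal_lift {A : AlmostQuaternionicStructure E M}
    {cov : Connection E M} (hcov : IsAlmostQuaternionicConnection A cov) {γ : ℝ → M}
    (hγ : ContMDiffAt 𝓘(ℝ, ℝ) 𝓘(ℝ, E) ∞ γ 0) (j : A.Z (γ 0)) :
    ∃ s : ∀ t, A.Z (γ t), s 0 = j ∧
      ContMDiffAt 𝓘(ℝ, ℝ) (endModel E) ∞ (fun t => (⟨γ t, (s t).1⟩ : EndTotal E M)) 0 ∧
      homCov 𝓘(ℝ, ℝ) cov cov γ γ (fun t => (s t).1) 0 unitTangent = 0 := by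
  obtain ⟨U, I, J, K, hUo, hxU, hsm, hU⟩ := A.exists_frame (γ 0)
  obtain ⟨hI, hJ, hK⟩ := hsm _ hxU
  obtain ⟨hT, hQ⟩ := hU _ hxU
  obtain ⟨a, b, c, habc, hj⟩ := hT.exists_coeff (by rw [← hQ]; exact j.2.1) j.2.2
  have hγd := hγ.mdifferentiableAt (by simp)
  have hUe : ∀ᶠ t in 𝓝 (0 : ℝ), γ t ∈ U := hγ.continuousAt (hUo.mem_nhds hxU)
  obtain ⟨s₀, hs₀, hs₀s⟩ := A.exists_lift hγ hUo hxU hI hJ hK hU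
    (a₁ := fun _ => a) (a₂ := fun _ => b) (a₃ := fun _ => c)
    contMDiffAt_const contMDiffAt_const contMDiffAt_const (fun _ => habc)
  have hd₀ := homDiffAt_of_contMDiffAt hs₀s
  -- The lift `s₀` with constant coefficients has a covariant derivative in `Q_M` anticommuting with
  -- `j`, hence with coefficients `(u, v, w)` orthogonal to `(a, b, c)`.
  have hW := homCov_mem hcov hd₀ (Filter.Eventually.of_forall fun t => (s₀ t).2.1) unitTangent
  have hWa := homCov_anticommute cov hd₀ (Filter.Eventually.of_forall fun t => (s₀ t).2.2) unitTangent
  rw [hs₀ 0 hxU] at hWa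
  rw [hQ] at hW
  obtain ⟨u, v, w, huvw, hWe⟩ := hT.exists_orthogonal_coeff hW hWa
  rw [homCov_congr cov cov (hUe.mono fun t ht => hs₀ t ht),
    homCov_frame₃ cov hγd hI hJ hK mdifferentiableAt_const mdifferentiableAt_const
      mdifferentiableAt_const, vderiv_const, vderiv_const, vderiv_const] at hWe
  have hm : 0 ≤ u ^ 2 + v ^ 2 + w ^ 2 := by positivity
  have h₁ := contMDiff_sphereCurve hm a u
  have h₂ := contMDiff_sphereCurve hm b v
  have h₃ := contMDiff_sphereCurve hm c w
  -- Moving the coefficients on the sphere with initial velocity `-(u, v, w)` cancels that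
  -- derivative at `0`.
  obtain ⟨s, hs, hss⟩ := A.exists_lift hγ hUo hxU hI hJ hK hU h₁.contMDiffAt h₂.contMDiffAt
    h₃.contMDiffAt (sphereCurve_sq habc huvw)
  refine ⟨s, ?_, hss, ?_⟩
  · refine Subtype.ext ((hs 0 hxU).trans ?_)
    rw [sphereCurve_zero, sphereCurve_zero, sphereCurve_zero, hj]
  · rw [homCov_congr cov cov (hUe.mono fun t ht => hs t ht),
      homCov_frame₃ cov hγd hI hJ hK (h₁.contMDiffAt.mdifferentiableAt (by simp))
        (h₂.contMDiffAt.mdifferentiableAt (by simp)) (h₃.contMDiffAt.mdifferentiableAt (by simp)),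
      vderiv_sphereCurve, vderiv_sphereCurve, vderiv_sphereCurve, sphereCurve_zero,
      sphereCurve_zero, sphereCurve_zero]
    have key : ∀ i j k d₁ d₂ d₃ : E →L[ℝ] E, ((0 : ℝ) • i + (0 : ℝ) • j + (0 : ℝ) • k) +
        (a • d₁ + b • d₂ + c • d₃) = u • i + v • j + w • k →
        (-u • i + -v • j + -w • k) + (a • d₁ + b • d₂ + c • d₃) = 0 := by
      intro i j k d₁ d₂ d₃ h
      rw [zero_smul, zero_smul, zero_smul, add_zero, add_zero, zero_add] at h
      rw [h]
      module
    exact key _ _ _ _ _ _ hWe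

/-- Horizontal vectors tangent to `Z_M` are velocities of curves in `Z_M`. -/
theorem AlmostQuaternionicStructure.exists_horizontal_curve {A : AlmostQuaternionicStructure E M}
    {cov : Connection E M} (hcov : IsAlmostQuaternionicConnection A cov) (x : M) (j : A.Z x)
    (X : TangentSpace 𝓘(ℝ, E) x) :
    ∃ (c : ℝ → A.TwistorSpace) (ξ : TangentSpace (endModel E) (A.incl ⟨x, j⟩)),
      SmoothCurveAt A c ∧ velocity A c = ⟨A.incl ⟨x, j⟩, ξ⟩ ∧
      horizontalPart (A.incl ⟨x, j⟩) ξ = X ∧ verticalPart cov (A.incl ⟨x, j⟩) ξ = 0 := by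
  obtain ⟨γ, hγ, hγX⟩ := exists_curve x X
  -- Equality in the tangent bundle permits substituting first the base point, then the vector over
  -- it.
  obtain rfl : γ 0 = x := congrArg TotalSpace.proj hγX
  obtain rfl : mfderiv 𝓘(ℝ, ℝ) 𝓘(ℝ, E) γ 0 unitTangent = X := TotalSpace.mk_inj.1 hγX
  obtain ⟨s, rfl, hs, hs0⟩ := exists_horizontal_lift hcov hγ j
  exact ⟨fun t => ⟨γ t, s t⟩,
    mfderiv 𝓘(ℝ, ℝ) (endModel E) (fun t => (⟨γ t, (s t).1⟩ : EndTotal E M)) 0 unitTangent, hs, rfl,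
    horizontalPart_mfderiv hs unitTangent, (verticalPart_mfderiv cov hs unitTangent).trans hs0⟩

end Lifts

/-! ## Quaternionic maps and the second fundamental form -/

section Maps

variable {E : Type*} [NormedAddCommGroup E] [NormedSpace ℝ E] [FiniteDimensional ℝ E]
  {M : Type*} [TopologicalSpace M] [ChartedSpace E M] [IsManifold 𝓘(ℝ, E) ∞ M]
  {E' : Type*} [NormedAddCommGroup E'] [NormedSpace ℝ E'] [FiniteDimensional ℝ E']
  {N : Type*} [TopologicalSpace N] [ChartedSpace E' N] [IsManifold 𝓘(ℝ, E') ∞ N]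
  {EB : Type*} [NormedAddCommGroup EB] [NormedSpace ℝ EB] {HB : Type*} [TopologicalSpace HB]
  {IB : ModelWithCorners ℝ EB HB} {B : Type*} [TopologicalSpace B] [ChartedSpace HB B]

/-- Near `b` the composite with `F` is the composite with a smooth local extension `G` of `F` to
`End(TM)`. -/
theorem SmoothTwistorMap.contMDiffAt {A : AlmostQuaternionicStructure E M}
    {A' : AlmostQuaternionicStructure E' N} {F : A.TwistorSpace → A'.TwistorSpace}
    (hF : SmoothTwistorMap F) {c : B → A.TwistorSpace} {b : B}
    (hc : ContMDiffAt IB (endModel E) ∞ (fun b => A.incl (c b)) b) :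
    ContMDiffAt IB (endModel E') ∞ (fun b => A'.incl (F (c b))) b := by
  obtain ⟨U, G, hUo, hU, hG, hGF⟩ := hF (c b)
  have h1 : ContMDiffAt (endModel E) (endModel E') ∞ G (A.incl (c b)) :=
    hG.contMDiffAt (hUo.mem_nhds hU)
  refine (ContMDiffAt.comp b h1 hc).congr_of_eventuallyEq ?_
  filter_upwards [hc.continuousAt (hUo.mem_nhds hU)] with b' hb'
  exact (hGF (c b') hb').symm

/-- The covariant derivative of the identity `dφ ∘ J = Φ(J) ∘ dφ` along a map into `Z_M`. -/
theorem homCov_lift_comp {A : AlmostQuaternionicStructure E M}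
    {A' : AlmostQuaternionicStructure E' N} {φ : M → N} {Φ : ∀ x : M, A.Z x → A'.Z (φ x)}
    (h : IsQuaternionicMap A A' φ Φ) (covM : Connection E M) (covN : Connection E' N)
    {f : B → M} {s : ∀ b, A.Z (f b)} {b : B}
    (hs : ContMDiffAt IB (endModel E) ∞ (fun b => (⟨f b, (s b).1⟩ : EndTotal E M)) b)
    (v : TangentSpace IB b) :
    HomDiffAt IB (fun b => φ (f b)) (fun b => φ (f b)) (fun b => (Φ (f b) (s b)).1) b ∧
    ∀ w : TangentSpace 𝓘(ℝ, E) (f b),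
      homCov IB covN covN (fun b => φ (f b)) (fun b => φ (f b)) (fun b => (Φ (f b) (s b)).1) b v
          (mfderiv 𝓘(ℝ, E) 𝓘(ℝ, E') φ (f b) w) +
        (Φ (f b) (s b)).1
          (secondFundamentalForm covM covN φ (f b) (mfderiv IB 𝓘(ℝ, E) f b v) w) =
      secondFundamentalForm covM covN φ (f b) (mfderiv IB 𝓘(ℝ, E) f b v) ((s b).1 w) +
        mfderiv 𝓘(ℝ, E) 𝓘(ℝ, E') φ (f b)
          (homCov IB covM covM f f (fun b => (s b).1) b v w) := by
  have hs' : HomDiffAt IB (fun b => φ (f b)) (fun b => φ (f b)) (fun b => (Φ (f b) (s b)).1) b :=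
    homDiffAt_of_contMDiffAt (h.smooth_lift.contMDiffAt (c := fun b => ⟨f b, s b⟩) hs)
  refine ⟨hs', fun w => ?_⟩
  have hd := homDiffAt_of_contMDiffAt hs
  have hφ := homDiffAt_mfderiv h.smooth (f b)
  have hφf : HomDiffAt IB f (fun b => φ (f b)) (fun b => mfderiv 𝓘(ℝ, E) 𝓘(ℝ, E') φ (f b)) b :=
    hφ.pullback hd.source
  have e : homCov IB covM covN f (fun b => φ (f b)) (fun b => mfderiv 𝓘(ℝ, E) 𝓘(ℝ, E') φ (f b)) b v
      = homCov 𝓘(ℝ, E) covM covN id φ (fun y => mfderiv 𝓘(ℝ, E) 𝓘(ℝ, E') φ y) (f b)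
        (mfderiv IB 𝓘(ℝ, E) f b v) := homCov_pullback covM covN hφ hd.source v
  -- The Leibniz rule on each side of `Φ(J) ∘ dφ = dφ ∘ J`; the derivative of `dφ` along `f` is
  -- `∇dφ` in the direction `df(v)`.
  have h1 := homCov_comp covM covN covN hs' hφf v
  have h2 := homCov_comp covM covM covN hφf hd v
  rw [homCov_congr covM covN (Filter.Eventually.of_forall fun b => (h.comm (f b) (s b)).symm),
    h2, e] at h1
  exact (congrArg (fun l : TangentSpace 𝓘(ℝ, E) (f b) →L[ℝ] TangentSpace 𝓘(ℝ, E') (φ (f b)) => l w)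
    h1).symm

theorem IsQuaternionicMap.qMap_eq {A : AlmostQuaternionicStructure E M}
    {A' : AlmostQuaternionicStructure E' N} {φ : M → N} {Φ : ∀ x : M, A.Z x → A'.Z (φ x)}
    (h : IsQuaternionicMap A A' φ Φ) (hφ : ∀ x, mfderiv 𝓘(ℝ, E) 𝓘(ℝ, E') φ x ≠ 0) (x : M)
    (j : A.Z x) : (h.qMap hφ x ⟨j.1, j.2.1⟩ : EndT E' (φ x)) = (Φ x j).1 :=
  (h.exists_linear_extension (hφ x)).choose_spec j

/-- Both sides are linear in `q`, and on the elements of `Z_M`, which span `Q_M`, this is the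
defining relation of a quaternionic map. -/
theorem IsQuaternionicMap.mfderiv_comp_qMap {A : AlmostQuaternionicStructure E M}
    {A' : AlmostQuaternionicStructure E' N} {φ : M → N} {Φ : ∀ x : M, A.Z x → A'.Z (φ x)}
    (h : IsQuaternionicMap A A' φ Φ) (hφ : ∀ x, mfderiv 𝓘(ℝ, E) 𝓘(ℝ, E') φ x ≠ 0) (x : M)
    (q : A.Q x) (w : TangentSpace 𝓘(ℝ, E) x) :
    mfderiv 𝓘(ℝ, E) 𝓘(ℝ, E') φ x (q.1 w) =
      (h.qMap hφ x q).1 (mfderiv 𝓘(ℝ, E) 𝓘(ℝ, E') φ x w) := by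
  obtain ⟨U, I, J, K, -, hxU, -, hU⟩ := A.exists_frame x
  obtain ⟨hT, hQ⟩ := hU x hxU
  have hI : I x ∈ A.Q x := by rw [hQ]; exact Submodule.subset_span (by simp)
  have hJ : J x ∈ A.Q x := by rw [hQ]; exact Submodule.subset_span (by simp)
  have hK : K x ∈ A.Q x := by rw [hQ]; exact Submodule.subset_span (by simp)
  have hj : ∀ j : A.Z x, mfderiv 𝓘(ℝ, E) 𝓘(ℝ, E') φ x (j.1 w) =
      (h.qMap hφ x ⟨j.1, j.2.1⟩).1 (mfderiv 𝓘(ℝ, E) 𝓘(ℝ, E') φ x w) := fun j => by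
    rw [h.qMap_eq hφ x j]
    exact congrArg (fun l : TangentSpace 𝓘(ℝ, E) x →L[ℝ] TangentSpace 𝓘(ℝ, E') (φ x) => l w)
      (h.comm x j)
  obtain ⟨q, hq⟩ := q
  have hq' := hq
  rw [hQ, Submodule.mem_span_triple] at hq'
  obtain ⟨a, b, c, rfl⟩ := hq'
  have e : (⟨a • I x + b • J x + c • K x, hq⟩ : A.Q x) =
      a • ⟨I x, hI⟩ + b • ⟨J x, hJ⟩ + c • ⟨K x, hK⟩ := rfl
  rw [e, map_add, map_add, map_smul, map_smul, map_smul]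
  have h1 := hj ⟨I x, hI, hT.1⟩
  have h2 := hj ⟨J x, hJ, hT.2.1⟩
  have h3 := hj ⟨K x, hK, hT.2.2.1⟩
  refine Eq.trans (b := a • mfderiv 𝓘(ℝ, E) 𝓘(ℝ, E') φ x (I x w) +
    b • mfderiv 𝓘(ℝ, E) 𝓘(ℝ, E') φ x (J x w) + c • mfderiv 𝓘(ℝ, E) 𝓘(ℝ, E') φ x (K x w)) ?_ ?_
  · exact ((mfderiv 𝓘(ℝ, E) 𝓘(ℝ, E') φ x).map_add _ _).trans (congrArg₂ _
      (((mfderiv 𝓘(ℝ, E) 𝓘(ℝ, E') φ x).map_add _ _).trans (congrArg₂ _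
        ((mfderiv 𝓘(ℝ, E) 𝓘(ℝ, E') φ x).map_smul _ _)
        ((mfderiv 𝓘(ℝ, E) 𝓘(ℝ, E') φ x).map_smul _ _)))
      ((mfderiv 𝓘(ℝ, E) 𝓘(ℝ, E') φ x).map_smul _ _))
  · rw [h1, h2, h3]
    rfl

/-- The pointwise condition on the second fundamental form `b` of a map with differential `d`, to
which the twistoriality reduces; `J` and `J'` are the corresponding complex structures. -/
def TwistorialForm {V V' : Type*} [AddCommGroup V] [Module ℝ V] [AddCommGroup V'] [Module ℝ V']
    (b : V →ₗ[ℝ] V →ₗ[ℝ] V') (J : V → V) (J' : V' → V') : Prop :=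
  ∀ X Y, b (J X) (J Y) = b X Y + J' (b (J X) Y + b X (J Y))

end Maps

/-! ### Complexified vectors and spaces of type `(0,1)`. -/

section Complexification

variable {V V' : Type*} [AddCommGroup V] [Module ℝ V] [AddCommGroup V'] [Module ℝ V']

theorem TensorProduct.exists_re_im (z : ℂ ⊗[ℝ] V) :
    ∃ X Y : V, z = (1 : ℂ) ⊗ₜ[ℝ] X + Complex.I ⊗ₜ[ℝ] Y := by
  induction z with
  | zero => exact ⟨0, 0, by simp⟩
  | tmul c X =>
    refine ⟨c.re • X, c.im • X, ?_⟩
    rw [← TensorProduct.smul_tmul, ← TensorProduct.smul_tmul, ← TensorProduct.add_tmul]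
    congr 1
    apply Complex.ext <;> simp
  | add z w hz hw =>
    obtain ⟨X, Y, rfl⟩ := hz
    obtain ⟨X', Y', rfl⟩ := hw
    refine ⟨X + X', Y + Y', ?_⟩
    rw [TensorProduct.tmul_add, TensorProduct.tmul_add]
    abel

theorem TensorProduct.re_im_inj {X Y X' Y' : V}
    (h : (1 : ℂ) ⊗ₜ[ℝ] X + Complex.I ⊗ₜ[ℝ] Y = (1 : ℂ) ⊗ₜ[ℝ] X' + Complex.I ⊗ₜ[ℝ] Y') :
    X = X' ∧ Y = Y' := by
  have hre := congrArg (fun z => TensorProduct.lid ℝ V (LinearMap.rTensor V Complex.reLm z)) h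
  have him := congrArg (fun z => TensorProduct.lid ℝ V (LinearMap.rTensor V Complex.imLm z)) h
  simp at hre him
  exact ⟨hre, him⟩

/-- Compare real and imaginary parts with `-i(X + iY) = Y - iX`. When `J² = -1`, the eigenvectors
are thus the `X + iJX`. -/
theorem mem_eigenspace_neg_I_iff (J : V →ₗ[ℝ] V) (X Y : V) :
    (1 : ℂ) ⊗ₜ[ℝ] X + Complex.I ⊗ₜ[ℝ] Y ∈ Module.End.eigenspace (J.baseChange ℂ) (-Complex.I) ↔
      J X = Y ∧ J Y = -X := by
  rw [Module.End.mem_eigenspace_iff]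
  have e : -Complex.I • ((1 : ℂ) ⊗ₜ[ℝ] X + Complex.I ⊗ₜ[ℝ] Y) =
      (1 : ℂ) ⊗ₜ[ℝ] Y + Complex.I ⊗ₜ[ℝ] (-X) := by
    rw [smul_add, TensorProduct.smul_tmul', TensorProduct.smul_tmul', TensorProduct.tmul_neg,
      ← TensorProduct.neg_tmul, add_comm]
    simp
  rw [e, map_add, LinearMap.baseChange_tmul, LinearMap.baseChange_tmul]
  constructor
  · intro h
    exact TensorProduct.re_im_inj h
  · rintro ⟨h1, h2⟩
    rw [h1, h2]

/-- The inclusion `b(V^{0,1}, V^{0,1}) ⊆ V'^{0,1}` in real terms. -/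
theorem baseChange_mem_eigenspace_iff (b : V →ₗ[ℝ] V →ₗ[ℝ] V') (J : V →ₗ[ℝ] V) (J' : V' →ₗ[ℝ] V')
    (hJ : ∀ X, J (J X) = -X) (hJ' : ∀ X, J' (J' X) = -X) :
    (∀ X ∈ Module.End.eigenspace (J.baseChange ℂ) (-Complex.I),
      ∀ Y ∈ Module.End.eigenspace (J.baseChange ℂ) (-Complex.I),
        LinearMap.BilinMap.baseChange ℂ b X Y ∈
          Module.End.eigenspace (J'.baseChange ℂ) (-Complex.I)) ↔ TwistorialForm b J J' := by
  -- Real and imaginary parts of `b` on two typical `(0,1)` vectors. `TwistorialForm` says that `J'`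
  -- sends the imaginary part to minus the real part; the other eigenvector equation follows from
  -- `J'² = -1`.
  have hb : ∀ X Y, LinearMap.BilinMap.baseChange ℂ b ((1 : ℂ) ⊗ₜ[ℝ] X + Complex.I ⊗ₜ[ℝ] (J X))
      ((1 : ℂ) ⊗ₜ[ℝ] Y + Complex.I ⊗ₜ[ℝ] (J Y)) =
        (1 : ℂ) ⊗ₜ[ℝ] (b X Y - b (J X) (J Y)) + Complex.I ⊗ₜ[ℝ] (b (J X) Y + b X (J Y)) := by
    intro X Y
    simp only [map_add, LinearMap.add_apply, LinearMap.BilinMap.baseChange_tmul, mul_one, one_mul,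
      Complex.I_mul_I, TensorProduct.tmul_add, TensorProduct.tmul_sub, TensorProduct.neg_tmul]
    abel
  have hX : ∀ X, (1 : ℂ) ⊗ₜ[ℝ] X + Complex.I ⊗ₜ[ℝ] (J X) ∈
      Module.End.eigenspace (J.baseChange ℂ) (-Complex.I) := fun X =>
    (mem_eigenspace_neg_I_iff J X (J X)).2 ⟨rfl, hJ X⟩
  constructor
  · intro h X Y
    have h1 := h _ (hX X) _ (hX Y)
    rw [hb, mem_eigenspace_neg_I_iff] at h1
    rw [h1.2]
    abel
  · intro h z hz w hw
    obtain ⟨X, X', rfl⟩ := TensorProduct.exists_re_im z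
    obtain ⟨Y, Y', rfl⟩ := TensorProduct.exists_re_im w
    obtain ⟨rfl, -⟩ := (mem_eigenspace_neg_I_iff J X X').1 hz
    obtain ⟨rfl, -⟩ := (mem_eigenspace_neg_I_iff J Y Y').1 hw
    rw [hb, mem_eigenspace_neg_I_iff]
    have h1 : b X Y - b (J X) (J Y) = -J' (b (J X) Y + b X (J Y)) := by
      rw [h X Y]; abel
    refine ⟨?_, ?_⟩
    · rw [h1, map_neg, hJ', neg_neg]
    · rw [h1, neg_neg]

end Complexification

/-! ## Characterizations of twistorial maps -/

section Twistorial

variable {E : Type*} [NormedAddCommGroup E] [NormedSpace ℝ E] [FiniteDimensional ℝ E]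
  {M : Type*} [TopologicalSpace M] [ChartedSpace E M] [IsManifold 𝓘(ℝ, E) ∞ M]
  {E' : Type*} [NormedAddCommGroup E'] [NormedSpace ℝ E'] [FiniteDimensional ℝ E']
  {N : Type*} [TopologicalSpace N] [ChartedSpace E' N] [IsManifold 𝓘(ℝ, E') ∞ N]

theorem AlmostQuaternionicStructure.Z.apply_apply {A : AlmostQuaternionicStructure E M} {x : M}
    (j : A.Z x) (w : TangentSpace 𝓘(ℝ, E) x) : j.1 (j.1 w) = -w :=
  congrArg (fun l : EndT E x => l w) j.2.2

theorem IsQuaternionicMap.mfderiv_apply {A : AlmostQuaternionicStructure E M}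
    {A' : AlmostQuaternionicStructure E' N} {φ : M → N} {Φ : ∀ x : M, A.Z x → A'.Z (φ x)}
    (h : IsQuaternionicMap A A' φ Φ) {x : M} (j : A.Z x) (w : TangentSpace 𝓘(ℝ, E) x) :
    mfderiv 𝓘(ℝ, E) 𝓘(ℝ, E') φ x (j.1 w) =
      (Φ x j).1 (mfderiv 𝓘(ℝ, E) 𝓘(ℝ, E') φ x w) :=
  congrArg (fun l : TangentSpace 𝓘(ℝ, E) x →L[ℝ] TangentSpace 𝓘(ℝ, E') (φ x) => l w) (h.comm x j)

theorem exists_mfderiv_ne_zero {φ : M → N} {x : M} (hx : mfderiv 𝓘(ℝ, E) 𝓘(ℝ, E') φ x ≠ 0) :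
    ∃ w, mfderiv 𝓘(ℝ, E) 𝓘(ℝ, E') φ x w ≠ 0 := by
  by_contra! hc
  exact hx (ContinuousLinearMap.ext hc)

/-- The point of `Z_M` at which the velocity of a curve is based. -/
theorem eq_of_velocity_eq {A : AlmostQuaternionicStructure E M} {c : ℝ → A.TwistorSpace}
    {p : A.TwistorSpace} {ξ : TangentSpace (endModel E) (A.incl p)}
    (h : velocity A c = ⟨A.incl p, ξ⟩) : c 0 = p := by
  have h1 : A.incl (c 0) = A.incl p := congrArg TotalSpace.proj h
  generalize c 0 = q at h1
  obtain ⟨x, j⟩ := q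
  obtain ⟨y, k⟩ := p
  obtain rfl : x = y := congrArg TotalSpace.proj h1
  obtain rfl : j = k := Subtype.ext (TotalSpace.mk_inj.1 h1)
  rfl

theorem exists_isPushforward {A : AlmostQuaternionicStructure E M}
    {A' : AlmostQuaternionicStructure E' N} (F : A.TwistorSpace → A'.TwistorSpace)
    {c : ℝ → A.TwistorSpace} {p : A.TwistorSpace} {ξ : TangentSpace (endModel E) (A.incl p)}
    (hc : SmoothCurveAt A c) (h : velocity A c = ⟨A.incl p, ξ⟩) :
    ∃ ξ', IsPushforward F p ξ ξ' := by
  obtain rfl := eq_of_velocity_eq h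
  exact ⟨_, c, hc, h, rfl⟩

/-- The horizontal and vertical components of the differential of the lift of a quaternionic
map. -/
theorem IsPushforward.components
    {A : QuaternionicStructure E M} {A' : QuaternionicStructure E' N} {φ : M → N}
    {Φ : ∀ x : M, A.Z x → A'.Z (φ x)}
    (h : IsQuaternionicMap A.toAlmostQuaternionicStructure A'.toAlmostQuaternionicStructure φ Φ)
    {p : A.TwistorSpace} {ξ : TangentSpace (endModel E) (A.incl p)}
    {ξ' : TangentSpace (endModel E') (A'.incl (totalLift φ Φ p))}
    (hξ : IsPushforward (totalLift φ Φ) p ξ ξ')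
    {X : TangentSpace 𝓘(ℝ, E) p.1} {V : EndT E p.1} {V' : EndT E' (φ p.1)}
    (hX : horizontalPart (A.incl p) ξ = X) (hV : verticalPart A.cov (A.incl p) ξ = V)
    (hV' : verticalPart A'.cov (A'.incl (totalLift φ Φ p)) ξ' = V') :
    horizontalPart (A'.incl (totalLift φ Φ p)) ξ' = mfderiv 𝓘(ℝ, E) 𝓘(ℝ, E') φ p.1 X ∧
      V' ∈ A'.Q (φ p.1) ∧
      ∀ w : TangentSpace 𝓘(ℝ, E) p.1,
        V' (mfderiv 𝓘(ℝ, E) 𝓘(ℝ, E') φ p.1 w) +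
          (Φ p.1 p.2).1 (secondFundamentalForm A.cov A'.cov φ p.1 X w) =
        secondFundamentalForm A.cov A'.cov φ p.1 X (p.2.1 w) +
          mfderiv 𝓘(ℝ, E) 𝓘(ℝ, E') φ p.1 (V w) := by
  obtain ⟨c, hc, hv, hv'⟩ := hξ
  -- Everything is expressed through the curve `c`, so that the components become covariant
  -- derivatives along `c` and along its image.
  obtain rfl := eq_of_velocity_eq hv
  obtain rfl := TotalSpace.mk_inj.1 hv
  obtain rfl := TotalSpace.mk_inj.1 hv'
  have hs : ContMDiffAt 𝓘(ℝ, ℝ) (endModel E) ∞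
      (fun t => (⟨(c t).1, (c t).2.1⟩ : EndTotal E M)) 0 := hc
  have hs' : ContMDiffAt 𝓘(ℝ, ℝ) (endModel E') ∞
      (fun t => (⟨φ (c t).1, (Φ (c t).1 (c t).2).1⟩ : EndTotal E' N)) 0 :=
    h.smooth_lift.contMDiffAt hc
  obtain ⟨hd', hw⟩ := homCov_lift_comp h A.cov A'.cov hs unitTangent
  have hf := (contMDiffAt_endTotal_iff.1 hs).1.mdifferentiableAt (by simp)
  have eH := horizontalPart_mfderiv hs unitTangent
  have eV := verticalPart_mfderiv A.cov hs unitTangent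
  have eH' := horizontalPart_mfderiv hs' unitTangent
  have eV' := verticalPart_mfderiv A'.cov hs' unitTangent
  obtain rfl := hX.symm.trans eH
  obtain rfl := hV.symm.trans eV
  obtain rfl := hV'.symm.trans eV'
  refine ⟨eH'.trans ?_, homCov_mem A'.almostQuaternionic hd'
    (Filter.Eventually.of_forall fun t => (Φ (c t).1 (c t).2).2.1) unitTangent, hw⟩
  exact mfderiv_comp_apply (0 : ℝ) ((h.smooth _).mdifferentiableAt (by simp)) hf unitTangent

variable {A : QuaternionicStructure E M} {A' : QuaternionicStructure E' N} {φ : M → N}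
  {Φ : ∀ x : M, A.Z x → A'.Z (φ x)}

/-- Only vertical components carry information, since `dφ` already intertwines `J` and `Φ(J)`.
Horizontal vectors give the identity; for a general vector, its own vertical component contributes
`dφ(Vw)`, which is compatible with `J` for the same reason. -/
theorem isTwistorial_iff
    (h : IsQuaternionicMap A.toAlmostQuaternionicStructure A'.toAlmostQuaternionicStructure φ Φ)
    (hφ : ∀ x : M, mfderiv 𝓘(ℝ, E) 𝓘(ℝ, E') φ x ≠ 0) :
    IsTwistorial A A' φ Φ ↔ ∀ (x : M) (j : A.Z x),
      TwistorialForm (secondFundamentalForm A.cov A'.cov φ x) j.1 (Φ x j).1 := by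
  constructor
  · rintro ⟨-, hT⟩ x j X w
    -- Take the horizontal lifts `ξ` of `X` and `η` of `JX`; then `η` is the image of `ξ` under
    -- `𝓙_M`.
    obtain ⟨c, ξ, hc, hcξ, hξX, hξ0⟩ :=
      AlmostQuaternionicStructure.exists_horizontal_curve A.almostQuaternionic x j X
    obtain ⟨d, η, hd, hdη, hηX, hη0⟩ :=
      AlmostQuaternionicStructure.exists_horizontal_curve A.almostQuaternionic x j (j.1 X)
    obtain ⟨ξ', hξ⟩ := exists_isPushforward (totalLift φ Φ) hc hcξ
    obtain ⟨η', hη⟩ := exists_isPushforward (totalLift φ Φ) hd hdη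
    have h1 := (hT ⟨x, j⟩ ξ η ξ' η' hξ hη
      ⟨by rw [hηX, hξX], by rw [hη0, hξ0]; exact (ContinuousLinearMap.comp_zero _).symm⟩).2
    have h2 := (IsPushforward.components h hξ hξX hξ0 rfl).2.2 w
    -- Passing `h1` makes the vertical part of `η'` appear directly as `Φ(J)` composed with that of
    -- `ξ'`.
    have h3 := (IsPushforward.components h hη hηX hη0 h1).2.2 w
    replace h2 := h2.trans ((congrArg _ (map_zero _)).trans (add_zero _))
    replace h3 := h3.trans ((congrArg _ (map_zero _)).trans (add_zero _))
    have h4 := congrArg (Φ x j).1 (eq_sub_of_add_eq h2)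
    rw [map_sub, AlmostQuaternionicStructure.Z.apply_apply, sub_neg_eq_add] at h4
    refine h3.symm.trans ((congrArg (· + _) h4).trans ?_)
    rw [map_add]
    abel
  · intro hF
    refine ⟨h.smooth_lift, fun p ξ η ξ' η' hξ hη ⟨hH, hV⟩ => ?_⟩
    obtain ⟨h1, h2, h3⟩ := IsPushforward.components h hξ rfl rfl rfl
    obtain ⟨k1, k2, k3⟩ := IsPushforward.components h hη hH hV rfl
    refine ⟨?_, ?_⟩
    · rw [k1, h1]
      exact h.mfderiv_apply p.2 _
    · obtain ⟨w, hw⟩ := exists_mfderiv_ne_zero (hφ p.1)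
      -- The vertical parts lie in `Q_N`, so they need comparing only on the nonzero vector `dφ w`.
      refine A'.eq_mul_of_apply_eq k2 (Φ p.1 p.2).2.1 h2 hw ?_
      have h4 := congrArg (Φ p.1 p.2).1 (eq_sub_of_add_eq (h3 w))
      rw [map_sub, map_add, AlmostQuaternionicStructure.Z.apply_apply, sub_neg_eq_add] at h4
      have h5 := h.mfderiv_apply p.2 (verticalPart A.cov (A.incl p) ξ w)
      have h6 := hF p.1 p.2 (horizontalPart (A.incl p) ξ) w
      refine (eq_sub_of_add_eq (k3 w)).trans (Eq.trans ?_ h4.symm)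
      rw [sub_eq_iff_eq_add, h6, map_add]
      refine (congrArg (_ + ·) h5).trans ?_
      abel

/-- The section `Φ(S)` of `Q_N` lives along `φ`, not over `N`, which is why `homCov_mem` is needed.
Membership allows testing (iii) on a single nonzero vector. -/
theorem connectionDifference_mem
    (h : IsQuaternionicMap A.toAlmostQuaternionicStructure A'.toAlmostQuaternionicStructure φ Φ)
    (hφ : ∀ x, mfderiv 𝓘(ℝ, E) 𝓘(ℝ, E') φ x ≠ 0) {x : M} (S : ∀ y : M, A.Z y)
    (hS : SmoothEndAt (fun y => (S y).1) x) (X : TangentSpace 𝓘(ℝ, E) x) :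
    connectionDifference h hφ S hS X ∈ A'.Q (φ x) :=
  Submodule.sub_mem _
    (homCov_mem A'.almostQuaternionic
      (homCov_lift_comp h A.cov A'.cov (f := fun y : M => y) hS X).1
      (Filter.Eventually.of_forall fun y => (Φ y (S y)).2.1) X)
    (Submodule.coe_mem _)

/-- In the differentiated relation `dφ ∘ S = Φ(S) ∘ dφ`, the term `dφ((∇S) w)` is exactly what the
transported `∇S` contributes, so it cancels. The outcome involves `S` only through its value at `x`.
-/
theorem connectionDifference_apply
    (h : IsQuaternionicMap A.toAlmostQuaternionicStructure A'.toAlmostQuaternionicStructure φ Φ)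
    (hφ : ∀ x, mfderiv 𝓘(ℝ, E) 𝓘(ℝ, E') φ x ≠ 0) {x : M} (S : ∀ y : M, A.Z y)
    (hS : SmoothEndAt (fun y => (S y).1) x) (X w : TangentSpace 𝓘(ℝ, E) x) :
    connectionDifference h hφ S hS X (mfderiv 𝓘(ℝ, E) 𝓘(ℝ, E') φ x w) =
      secondFundamentalForm A.cov A'.cov φ x X ((S x).1 w) -
        (Φ x (S x)).1 (secondFundamentalForm A.cov A'.cov φ x X w) := by
  have h1 := (homCov_lift_comp h A.cov A'.cov (f := fun y : M => y) hS X).2 w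
  have e : mfderiv 𝓘(ℝ, E) 𝓘(ℝ, E) (fun y : M => y) x X = X :=
    congrArg (fun l : TangentSpace 𝓘(ℝ, E) x →L[ℝ] TangentSpace 𝓘(ℝ, E) x => l X) mfderiv_id
  rw [e] at h1
  have h2 := h.mfderiv_comp_qMap hφ x ⟨endCov A.cov (fun y => (S y).1) x X,
        A.almostQuaternionic x _ hS (Filter.Eventually.of_forall fun y => (S y).2.1) X⟩ w
  have key : ∀ a b c d d' : TangentSpace 𝓘(ℝ, E') (φ x), a + b = c + d → d = d' →
      a - d' = c - b := by
    rintro a b c d d' h rfl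
    rw [sub_eq_sub_iff_add_eq_add, h]
  exact key _ _ _ _ _ h1 h2

/-- Evaluated on `dφ w` by `connectionDifference_apply`, condition (iii) rearranges into the
identity with arguments `X` and `w`, using `Φ(J)² = -1`. -/
theorem connectionDifference_iff
    (h : IsQuaternionicMap A.toAlmostQuaternionicStructure A'.toAlmostQuaternionicStructure φ Φ)
    (hφ : ∀ x : M, mfderiv 𝓘(ℝ, E) 𝓘(ℝ, E') φ x ≠ 0) :
    (∀ (x : M) (S : ∀ y : M, A.Z y) (hS : SmoothEndAt (fun y => (S y).1) x)
        (X : TangentSpace 𝓘(ℝ, E) x),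
        connectionDifference h hφ S hS ((S x).1 X)
          = (Φ x (S x)).1 * connectionDifference h hφ S hS X) ↔
      ∀ (x : M) (j : A.Z x),
        TwistorialForm (secondFundamentalForm A.cov A'.cov φ x) j.1 (Φ x j).1 := by
  constructor
  · intro hD x j X w
    -- Condition (iii) is phrased with local sections, so `j` is first extended to one.
    obtain ⟨S, rfl, hS⟩ := A.exists_section j
    have h1 := congrArg (fun l : EndT E' (φ x) => l (mfderiv 𝓘(ℝ, E) 𝓘(ℝ, E') φ x w)) (hD x S hS X)
    replace h1 : connectionDifference h hφ S hS ((S x).1 X) (mfderiv 𝓘(ℝ, E) 𝓘(ℝ, E') φ x w) =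
      (Φ x (S x)).1 (connectionDifference h hφ S hS X (mfderiv 𝓘(ℝ, E) 𝓘(ℝ, E') φ x w)) := h1
    rw [connectionDifference_apply, connectionDifference_apply, map_sub,
      AlmostQuaternionicStructure.Z.apply_apply, sub_neg_eq_add, sub_eq_iff_eq_add] at h1
    rw [h1, map_add]
    abel
  · intro hF x S hS X
    obtain ⟨w, hw⟩ := exists_mfderiv_ne_zero (hφ x)
    refine A'.eq_mul_of_apply_eq (connectionDifference_mem h hφ S hS _) (Φ x (S x)).2.1
      (connectionDifference_mem h hφ S hS _) hw ?_
    rw [connectionDifference_apply, connectionDifference_apply, map_sub,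
      AlmostQuaternionicStructure.Z.apply_apply, hF x (S x) X w, map_add]
    abel

end Twistorial

end

/-! ### The equivalence of the three assertions. -/

theorem proposition3p2
    {E : Type*} [NormedAddCommGroup E] [NormedSpace ℝ E] [FiniteDimensional ℝ E]
    {M : Type*} [TopologicalSpace M] [T2Space M] [SecondCountableTopology M]
    [ChartedSpace E M] [IsManifold 𝓘(ℝ, E) ∞ M]
    {E' : Type*} [NormedAddCommGroup E'] [NormedSpace ℝ E'] [FiniteDimensional ℝ E']
    {N : Type*} [TopologicalSpace N] [T2Space N] [SecondCountableTopology N]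
    [ChartedSpace E' N] [IsManifold 𝓘(ℝ, E') ∞ N]
    (A : QuaternionicStructure E M) (A' : QuaternionicStructure E' N)
    (φ : M → N) (Φ : ∀ x : M, A.Z x → A'.Z (φ x))
    (h : IsQuaternionicMap A.toAlmostQuaternionicStructure A'.toAlmostQuaternionicStructure φ Φ)
    (hφ : ∀ x : M, mfderiv 𝓘(ℝ, E) 𝓘(ℝ, E') φ x ≠ 0) :
    List.TFAE [
      IsTwistorial A A' φ Φ,
      ∀ (x : M) (J : A.Z x), ∀ X ∈ T01 J.1, ∀ Y ∈ T01 J.1,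
        LinearMap.BilinMap.baseChange ℂ (secondFundamentalForm A.cov A'.cov φ x) X Y ∈ T01 (Φ x J).1,
      ∀ (x : M) (S : ∀ y : M, A.Z y) (hS : SmoothEndAt (fun y => (S y).1) x)
        (X : TangentSpace 𝓘(ℝ, E) x),
        connectionDifference h hφ S hS ((S x).1 X)
          = (Φ x (S x)).1 * connectionDifference h hφ S hS X] := by
  have h₁ := isTwistorial_iff h hφ
  have h₂ : (∀ (x : M) (J : A.Z x), ∀ X ∈ T01 J.1, ∀ Y ∈ T01 J.1,
      LinearMap.BilinMap.baseChange ℂ (secondFundamentalForm A.cov A'.cov φ x) X Y ∈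
        T01 (Φ x J).1) ↔ ∀ (x : M) (J : A.Z x),
      TwistorialForm (secondFundamentalForm A.cov A'.cov φ x) J.1 (Φ x J).1 :=
    forall₂_congr fun x J => baseChange_mem_eigenspace_iff _ J.1.toLinearMap (Φ x J).1.toLinearMap
      (AlmostQuaternionicStructure.Z.apply_apply J)
      (AlmostQuaternionicStructure.Z.apply_apply (Φ x J))
  have h₃ := connectionDifference_iff h hφ
  tfae_have 1 ↔ 2 := h₁.trans h₂.symm
  tfae_have 1 ↔ 3 := h₁.trans h₃.symm
  tfae_finish
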